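/- **Setting.** For complex matrices $X,Y$ of the same size put $\Delta(X,Y)=\begin{pmatrix}X&Y\\ \overline{Y}&\overline{X}\end{pmatrix}$ (bars denote entrywise complex conjugation), let $J_n=\mathrm{diag}(1_n,-1_n)$, $V_{\mathrm{vac}}=\mathrm{diag}(1_n,0_n)$, and $Z^\flat=J_nZ^\dagger J_m$ for $Z\in\mathbb C^{2m\times 2n}$. A *quantum linear system* (QLS) with $n$ modes and $m$ field channels (no scattering or squeezing in the field) is a pair $(C,A)$ with $C=\Delta(C_-,C_+)\in\mathbb C^{2m\times 2n}$, $A=\Delta(A_-,A_+)\in\mathbb C^{2n\times 2n}$ and $A+A^\flat+C^\flat C=0$. It is *stable* if all eigenvalues of $A$ have negative real part. All QLSs below are stable and have the same number $m$ of channels. The transfer function is $\Xi(s)=1-C(s-A)^{-1}C^\flat$ and the power spectrum for vacuum input is $\Psi(s)=\Xi(s)V_{\mathrm{vac}}\Xi(-\overline{s})^\dagger$; both are regarded as rational functions of $s$. Two QLSs are *transfer-function equivalent* (TFE) if their transfer functions coincide. A QLS is *globally minimal* (for vacuum input) if no QLS with fewer modes has the same power spectrum, and its power spectrum is *trivial*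 if $\Psi(s)=V_{\mathrm{vac}}$. The covariance matrix $P=\langle\breve{\mathbf a}\breve{\mathbf a}^\dagger\rangle$ of the stationary state for vacuum input is the solution of $AP+PA^\dagger+C^\flat V_{\mathrm{vac}}(C^\flat)^\dagger=0$; the stationary state is *pure* if $SPS^\dagger=V_{\mathrm{vac}}$ for some symplectic $S$, that is, $S=\Delta(S_-,S_+)$ with $S^\flat S=SS^\flat=1$. The cascade $(C_2,A_2)\triangleleft(C_1,A_1)$ (the output of the first system is the input of the second) is, with modes ordered as $(\breve{\mathbf a}_1,\breve{\mathbf a}_2)$, $$\left((C_1,\;C_2),\;\begin{pmatrix}A_1&0\\-C_2^\flat C_1&A_2\end{pmatrix}\right).$$ **Theorem.** Let $\mathcal G=(C_2,A_2)\triangleleft(C_1,A_1)$ be a cascade with $n$ modes, where $(C_1,A_1)$ has one mode and is globally minimal, and $(C_2,A_2)$ has $n-1$ modes. Suppose that, for vacuum input, $\mathcal G$ has a pure stationary state. Then $n\ge 2$, and there are a one-mode QLS $(C'_{2_1},A'_{2_1})$ and an $(n-2)$-mode QLS $(C'_{2_2},A'_{2_2})$ such that 1. the cascade $(C'_{2_2},A'_{2_2})\triangleleft(C'_{2_1},A'_{2_1})$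 is TFE to $(C_2,A_2)$; 2. $(C'_{2_1},A'_{2_1})$ is globally minimal; 3. $(C'_{2_1},A'_{2_1})\triangleleft(C_1,A_1)$ has a pure stationary state and a trivial power spectrum for vacuum input. Thus modes are reducible from the power spectrum in pairs: the remaining $(n-2)$-mode system $(C'_{2_2},A'_{2_2})$ again has a pure stationary state for vacuum input, and it has the same power spectrum as $\mathcal G$. -/

import Mathlib

namespace QuantumLinear

open Matrix

/-- The doubled-up matrix `Δ(X, Y) = [[X, Y], [Y#, X#]]`, where `#` is entrywise complex
conjugation. -/
def doubleUp {κ ι : Type*} (X Y : Matrix κ ι ℂ) : Matrix (κ ⊕ κ) (ι ⊕ ι) ℂ :=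
  fromBlocks X Y (Y.map star) (X.map star)

/-- `J = diag(1, -1)` on doubled-up vectors. -/
def J (ι : Type*) [DecidableEq ι] : Matrix (ι ⊕ ι) (ι ⊕ ι) ℂ :=
  fromBlocks 1 0 0 (-1)

/-- The symplectic adjoint `Z♭ = J Z† J`. -/
def flat {κ ι : Type*} [Fintype κ] [DecidableEq κ] [Fintype ι] [DecidableEq ι]
    (Z : Matrix (κ ⊕ κ) (ι ⊕ ι) ℂ) : Matrix (ι ⊕ ι) (κ ⊕ κ) ℂ :=
  J ι * Zᴴ * J κ

/-- The vacuum covariance matrix `diag(1, 0)`; it is used both for the fields and for modes. -/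
def vac (ι : Type*) [DecidableEq ι] : Matrix (ι ⊕ ι) (ι ⊕ ι) ℂ :=
  fromBlocks 1 0 0 0

/-- Symplectic matrices: doubled-up and `♭`-unitary. -/
def IsSymplectic {ι : Type*} [Fintype ι] [DecidableEq ι]
    (S : Matrix (ι ⊕ ι) (ι ⊕ ι) ℂ) : Prop :=
  (∃ X Y : Matrix ι ι ℂ, S = doubleUp X Y) ∧ flat S * S = 1 ∧ S * flat S = 1

/-- A covariance matrix `⟨ă ă†⟩` belongs to a pure Gaussian state if all its symplectic
eigenvalues vanish: some symplectic change of modes turns it into the vacuum covariance. -/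
def IsPureCov {ι : Type*} [Fintype ι] [DecidableEq ι]
    (P : Matrix (ι ⊕ ι) (ι ⊕ ι) ℂ) : Prop :=
  ∃ S : Matrix (ι ⊕ ι) (ι ⊕ ι) ℂ, IsSymplectic S ∧ S * P * Sᴴ = vac ι

/-- A quantum linear system `(C, A)` with `m` field channels, modes indexed by `ι`, and neither
scattering nor squeezing in the fields: `C = Δ(C₋, C₊)` and `A = Δ(A₋, A₊)` satisfy the
physical realizability condition `A + A♭ + C♭ C = 0`. Equivalently (see `realizable_iff_exists`),
the dynamics comes from a coupling `C₋ a + C₊ a#` and a quadratic Hamiltonian `(Ω₋, Ω₊)`. -/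
structure QLS (m : ℕ) (ι : Type) [Fintype ι] [DecidableEq ι] where
  Cminus : Matrix (Fin m) ι ℂ
  Cplus : Matrix (Fin m) ι ℂ
  Aminus : Matrix ι ι ℂ
  Aplus : Matrix ι ι ℂ
  realizable : doubleUp Aminus Aplus + flat (doubleUp Aminus Aplus)
    + flat (doubleUp Cminus Cplus) * doubleUp Cminus Cplus = 0

namespace QLS

variable {m : ℕ} {ι ι₁ ι₂ : Type} [Fintype ι] [DecidableEq ι] [Fintype ι₁] [DecidableEq ι₁]
  [Fintype ι₂] [DecidableEq ι₂]

/-- The doubled-up coupling matrix `C`. -/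
def C (G : QLS m ι) : Matrix (Fin m ⊕ Fin m) (ι ⊕ ι) ℂ := doubleUp G.Cminus G.Cplus

/-- The doubled-up system matrix `A`. -/
def A (G : QLS m ι) : Matrix (ι ⊕ ι) (ι ⊕ ι) ℂ := doubleUp G.Aminus G.Aplus

/-- Hurwitz stability (equivalently, ergodicity). -/
def IsHurwitz (G : QLS m ι) : Prop := ∀ z ∈ spectrum ℂ G.A, z.re < 0

/-- The transfer function `Ξ(s) = 1 - C (s - A)⁻¹ C♭`; meaningful for `s` off the spectrum of
`A`. -/
noncomputable def transfer (G : QLS m ι) (s : ℂ) : Matrix (Fin m ⊕ Fin m) (Fin m ⊕ Fin m) ℂ :=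
  1 - G.C * (s • (1 : Matrix (ι ⊕ ι) (ι ⊕ ι) ℂ) - G.A)⁻¹ * flat G.C

/-- The power spectrum for vacuum input, `Ψ(s) = Ξ(s) V_vac Ξ(-s*)†`; meaningful when neither `s`
nor `-s*` is an eigenvalue of `A`. -/
noncomputable def powerSpectrum (G : QLS m ι) (s : ℂ) :
    Matrix (Fin m ⊕ Fin m) (Fin m ⊕ Fin m) ℂ :=
  G.transfer s * vac (Fin m) * (G.transfer (-star s))ᴴ

/-- `s` and `-s*` are both off the spectrum of `A`. -/
def IsRegularAt (G : QLS m ι) (s : ℂ) : Prop :=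
  s ∉ spectrum ℂ G.A ∧ -star s ∉ spectrum ℂ G.A

/-- Transfer function equivalence (TFE): the transfer functions agree wherever both are
defined, i.e. as rational functions. -/
def TransferEquiv (G₁ : QLS m ι₁) (G₂ : QLS m ι₂) : Prop :=
  ∀ s : ℂ, s ∉ spectrum ℂ G₁.A → s ∉ spectrum ℂ G₂.A → G₁.transfer s = G₂.transfer s

/-- Power spectrum equivalence for vacuum input: the power spectra agree wherever both are
defined, i.e. as rational functions. -/
def PowerEquiv (G₁ : QLS m ι₁) (G₂ : QLS m ι₂) : Prop :=
  ∀ s : ℂ, G₁.IsRegularAt s → G₂.IsRegularAt s → G₁.powerSpectrum s = G₂.powerSpectrum s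

/-- The power spectrum is trivial: the output covariance is that of the vacuum input. -/
def HasTrivialPowerSpectrum (G : QLS m ι) : Prop :=
  ∀ s : ℂ, G.IsRegularAt s → G.powerSpectrum s = vac (Fin m)

/-- Global minimality for vacuum input: no (stable) system with fewer modes has the same power
spectrum. -/
def IsGloballyMinimal (G : QLS m ι) : Prop :=
  ∀ k : ℕ, k < Fintype.card ι → ∀ G' : QLS m (Fin k), G'.IsHurwitz → ¬ G'.PowerEquiv G

/-- `P` is the covariance matrix of the stationary state for vacuum input: it solves the Lyapunov
equation `A P + P A† + C♭ V_vac (C♭)† = 0` (the solution is unique for a stable system). -/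
def IsStationaryCov (G : QLS m ι) (P : Matrix (ι ⊕ ι) (ι ⊕ ι) ℂ) : Prop :=
  G.A * P + P * G.Aᴴ + flat G.C * vac (Fin m) * (flat G.C)ᴴ = 0

/-- The stationary state for vacuum input is pure. -/
def HasPureStationaryState (G : QLS m ι) : Prop :=
  ∃ P, G.IsStationaryCov P ∧ IsPureCov P

end QLS

theorem flat_doubleUp {κ ι : Type*} [Fintype κ] [DecidableEq κ] [Fintype ι] [DecidableEq ι]
    (X Y : Matrix κ ι ℂ) : flat (doubleUp X Y) = doubleUp Xᴴ (-Yᵀ) := by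
  ext i j
  rcases i with i | i <;> rcases j with j | j <;>
    simp [flat, doubleUp, J, fromBlocks_conjTranspose, fromBlocks_multiply, Matrix.map_apply,
      conjTranspose_apply]

theorem doubleUp_mul {κ ι μ : Type*} [Fintype ι]
    (X Y : Matrix κ ι ℂ) (Z W : Matrix ι μ ℂ) :
    doubleUp X Y * doubleUp Z W
      = doubleUp (X * Z + Y * W.map star) (X * W + Y * Z.map star) := by
  ext i j
  rcases i with i | i <;> rcases j with j | j <;>
    simp [doubleUp, Matrix.mul_apply, add_comm]

theorem doubleUp_add {κ ι : Type*} (X Y Z W : Matrix κ ι ℂ) :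
    doubleUp X Y + doubleUp Z W = doubleUp (X + Z) (Y + W) := by
  ext i j
  rcases i with i | i <;> rcases j with j | j <;> simp [doubleUp]

theorem doubleUp_eq_zero {κ ι : Type*} {X Y : Matrix κ ι ℂ} :
    doubleUp X Y = 0 ↔ X = 0 ∧ Y = 0 := by
  constructor
  · intro h
    constructor
    · ext i j
      simpa [doubleUp] using congrFun (congrFun h (Sum.inl i)) (Sum.inl j)
    · ext i j
      simpa [doubleUp] using congrFun (congrFun h (Sum.inl i)) (Sum.inr j)
  · rintro ⟨rfl, rfl⟩
    ext i j
    rcases i with i | i <;> rcases j with j | j <;> simp [doubleUp]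

/-- The physical realizability condition in terms of the undoubled matrices. -/
theorem realizable_iff {κ ι : Type*} [Fintype κ] [DecidableEq κ] [Fintype ι] [DecidableEq ι]
    (X Y : Matrix κ ι ℂ) (Z W : Matrix ι ι ℂ) :
    doubleUp Z W + flat (doubleUp Z W) + flat (doubleUp X Y) * doubleUp X Y = 0 ↔
      Z + Zᴴ + (Xᴴ * X - Yᵀ * Y.map star) = 0 ∧ W - Wᵀ + (Xᴴ * Y - Yᵀ * X.map star) = 0 := by
  rw [flat_doubleUp, flat_doubleUp, doubleUp_mul, doubleUp_add, doubleUp_add, doubleUp_eq_zero]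
  simp only [Matrix.neg_mul, ← sub_eq_add_neg]

/-- Physical realizability means that `A = -½ C♭ C - i J Ω` for a Hamiltonian matrix
`Ω = Δ(Ω₋, Ω₊)` with `Ω₋` Hermitian and `Ω₊` symmetric; here in undoubled form. -/
theorem realizable_iff_exists {κ ι : Type*} [Fintype κ] [DecidableEq κ] [Fintype ι]
    [DecidableEq ι] (X Y : Matrix κ ι ℂ) (Z W : Matrix ι ι ℂ) :
    doubleUp Z W + flat (doubleUp Z W) + flat (doubleUp X Y) * doubleUp X Y = 0 ↔
      ∃ Ωm Ωp : Matrix ι ι ℂ, Ωmᴴ = Ωm ∧ Ωpᵀ = Ωp ∧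
        doubleUp Z W = -((1 / 2 : ℂ) • (flat (doubleUp X Y) * doubleUp X Y))
          - Complex.I • (J ι * doubleUp Ωm Ωp) := by
  have key : ∀ Ωm Ωp : Matrix ι ι ℂ,
      (doubleUp Z W = -((1 / 2 : ℂ) • (flat (doubleUp X Y) * doubleUp X Y))
          - Complex.I • (J ι * doubleUp Ωm Ωp)) ↔
      (Z = -((1 / 2 : ℂ) • (Xᴴ * X - Yᵀ * Y.map star)) - Complex.I • Ωm ∧
        W = -((1 / 2 : ℂ) • (Xᴴ * Y - Yᵀ * X.map star)) - Complex.I • Ωp) := by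
    intro Ωm Ωp
    have e : -((1 / 2 : ℂ) • (flat (doubleUp X Y) * doubleUp X Y))
          - Complex.I • (J ι * doubleUp Ωm Ωp)
        = doubleUp (-((1 / 2 : ℂ) • (Xᴴ * X - Yᵀ * Y.map star)) - Complex.I • Ωm)
            (-((1 / 2 : ℂ) • (Xᴴ * Y - Yᵀ * X.map star)) - Complex.I • Ωp) := by
      rw [flat_doubleUp, doubleUp_mul, J]
      ext i j
      rcases i with i | i <;> rcases j with j | j <;>
        simp [doubleUp, fromBlocks_multiply, map_ofNat] <;> ring
    rw [e, ← sub_eq_zero, ← sub_eq_zero (a := Z), ← sub_eq_zero (a := W), ← doubleUp_eq_zero]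
    have e' : ∀ Z' W' : Matrix ι ι ℂ,
        doubleUp Z W - doubleUp Z' W' = doubleUp (Z - Z') (W - W') := by
      intro Z' W'
      ext i j
      rcases i with i | i <;> rcases j with j | j <;> simp [doubleUp]
    rw [e']
  simp only [key, realizable_iff]
  have hK : (Xᴴ * X - Yᵀ * Y.map star)ᴴ = Xᴴ * X - Yᵀ * Y.map star := by
    ext i j
    simp [Matrix.mul_apply, mul_comm]
  have hL : (Xᴴ * Y - Yᵀ * X.map star)ᵀ = -(Xᴴ * Y - Yᵀ * X.map star) := by
    ext i j
    simp [Matrix.mul_apply, mul_comm]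
  generalize Xᴴ * X - Yᵀ * Y.map star = K at *
  generalize Xᴴ * Y - Yᵀ * X.map star = L at *
  have hI : Complex.I * Complex.I = -1 := Complex.I_mul_I
  constructor
  · rintro ⟨h₁, h₂⟩
    refine ⟨Complex.I • (Z + (1 / 2 : ℂ) • K), Complex.I • (W + (1 / 2 : ℂ) • L), ?_, ?_, ?_, ?_⟩
    · have : Zᴴ = -Z - K := by rw [← sub_eq_zero, ← h₁]; abel
      rw [conjTranspose_smul, conjTranspose_add, conjTranspose_smul, hK, this]
      ext i j
      simp
      ring
    · have : Wᵀ = W + L := by rw [← sub_eq_zero, ← neg_eq_zero, ← h₂]; abel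
      rw [transpose_smul, transpose_add, transpose_smul, hL, this]
      ext i j
      simp
      ring
    · ext i j
      simp
      linear_combination (Z i j + 1 / 2 * K i j) * hI
    · ext i j
      simp
      linear_combination (W i j + 1 / 2 * L i j) * hI
  · rintro ⟨Ωm, Ωp, h₁, h₂, rfl, rfl⟩
    constructor
    · rw [conjTranspose_sub, conjTranspose_neg, conjTranspose_smul, conjTranspose_smul, hK, h₁]
      ext i j
      simp
      ring
    · rw [transpose_sub, transpose_neg, transpose_smul, transpose_smul, hL, h₂]
      ext i j
      simp
      ring

namespace QLS

variable {m : ℕ} {ι ι₁ ι₂ : Type} [Fintype ι] [DecidableEq ι] [Fintype ι₁] [DecidableEq ι₁]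
  [Fintype ι₂] [DecidableEq ι₂]

/-- The cascade (series product) `G₂ ◁ G₁`: the output of `G₁` is the input of `G₂`. Its modes are
those of `G₁` followed by those of `G₂`, and, in the ordering `(ă₁, ă₂)` of the doubled-up modes,
`C = (C₁, C₂)` and `A = [[A₁, 0], [-C₂♭ C₁, A₂]]` (see `series_C` and `series_A`). -/
def series (G₂ : QLS m ι₂) (G₁ : QLS m ι₁) : QLS m (ι₁ ⊕ ι₂) where
  Cminus := fromCols G₁.Cminus G₂.Cminus
  Cplus := fromCols G₁.Cplus G₂.Cplus
  Aminus := fromBlocks G₁.Aminus 0 (-(flat G₂.C * G₁.C).toBlocks₁₁) G₂.Aminus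
  Aplus := fromBlocks G₁.Aplus 0 (-(flat G₂.C * G₁.C).toBlocks₁₂) G₂.Aplus
  realizable := by
    have h₁ := (realizable_iff _ _ _ _).1 G₁.realizable
    have h₂ := (realizable_iff _ _ _ _).1 G₂.realizable
    have e₁ : (flat G₂.C * G₁.C).toBlocks₁₁
        = G₂.Cminusᴴ * G₁.Cminus - G₂.Cplusᵀ * G₁.Cplus.map star := by
      rw [C, C, flat_doubleUp, doubleUp_mul, doubleUp, toBlocks_fromBlocks₁₁, Matrix.neg_mul,
        sub_eq_add_neg]
    have e₂ : (flat G₂.C * G₁.C).toBlocks₁₂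
        = G₂.Cminusᴴ * G₁.Cplus - G₂.Cplusᵀ * G₁.Cminus.map star := by
      rw [C, C, flat_doubleUp, doubleUp_mul, doubleUp, toBlocks_fromBlocks₁₂, Matrix.neg_mul,
        sub_eq_add_neg]
    rw [realizable_iff, e₁, e₂]
    constructor
    · ext i j
      rcases i with i | i <;> rcases j with j | j
      · simpa [Matrix.mul_apply, conjTranspose_apply] using congrFun (congrFun h₁.1 i) j
      · simp [Matrix.mul_apply, conjTranspose_apply, mul_comm]
      · simp [Matrix.mul_apply, conjTranspose_apply]
      · simpa [Matrix.mul_apply, conjTranspose_apply] using congrFun (congrFun h₂.1 i) j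
    · ext i j
      rcases i with i | i <;> rcases j with j | j
      · simpa [Matrix.mul_apply, conjTranspose_apply] using congrFun (congrFun h₁.2 i) j
      · simp [Matrix.mul_apply, conjTranspose_apply, mul_comm]
      · simp [Matrix.mul_apply, conjTranspose_apply]
      · simpa [Matrix.mul_apply, conjTranspose_apply] using congrFun (congrFun h₂.2 i) j

theorem series_C (G₂ : QLS m ι₂) (G₁ : QLS m ι₁) :
    (G₂.series G₁).C.submatrix id (Equiv.sumSumSumComm ι₁ ι₁ ι₂ ι₂)
      = fromCols G₁.C G₂.C := by
  ext i j
  rcases i with i | i <;> rcases j with (j | j) | (j | j) <;> simp [series, C, doubleUp]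

theorem series_A (G₂ : QLS m ι₂) (G₁ : QLS m ι₁) :
    (G₂.series G₁).A.submatrix (Equiv.sumSumSumComm ι₁ ι₁ ι₂ ι₂)
        (Equiv.sumSumSumComm ι₁ ι₁ ι₂ ι₂)
      = fromBlocks G₁.A 0 (-(flat G₂.C * G₁.C)) G₂.A := by
  have e : flat G₂.C * G₁.C
      = doubleUp (flat G₂.C * G₁.C).toBlocks₁₁ (flat G₂.C * G₁.C).toBlocks₁₂ := by
    rw [C, C, flat_doubleUp, doubleUp_mul]
    simp [doubleUp]
  rw [e]
  ext i j
  rcases i with (i | i) | (i | i) <;> rcases j with (j | j) | (j | j) <;>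
    simp [series, A, doubleUp, -neg_sub]

end QLS

end QuantumLinear

/-! The stationary covariance `P` is replaced by `Q = P J`. Purity makes `Q` an idempotent with `Q♭
= Q` and `Q# = 1 - Q` (`sharp`), and `Q J` is positive. Realizability turns the Lyapunov equation
into `AQ - QA - Q C♭C + C♭ V C = 0`. For idempotent `Q`, compressing this by `1 - Q` and using
positivity of `V` gives `CQ = VC` and then `AQ = QA` (`isPassiveFor_of_isStationaryCov`). The system
is thus passive in the modes for which `Q` is the vacuum projection, so its transfer function
commutes with `V` and its power spectrum is trivial.

Write `Q` in blocks along the two parts of the cascade. The block `Q₁` is a stationary state of the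
one-mode system `G₁`, and `Q₁² - Q₁ = δ` with a scalar `δ ≥ 0`. If `δ = 0`, then `G₁` would itself
be passive with trivial spectrum, which global minimality excludes. Hence `δ > 0`: the mode of `G₁`
is correlated with `G₂`. The off-diagonal block `X` satisfies `X♭X = -δ`, so it is an invertible
multiple of a symplectic pair of vectors `U`, which singles out one mode of `G₂`
(`exists_correlated_mode`).

Complete `U` to a symplectic basis `(U, W)` (`exists_symplectic_completion`). Since `Q` commutes
with the block triangular `A`, the block `X♭` intertwines `A₂` with `A₁`. Therefore the kernel of
`U♭`, which is the range of `W`, is invariant under `A₂`. This makes `G₂` a cascade in the modes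
`U`, `W` (`series_pull_pull`), and `U♭ A₂ U` is similar to `A₁`. Finally `Q` has no entries between
the pair (`G₁`, `U`) and `W`, so both compressions are again pure and passive. If the new one-mode
system had trivial spectrum, cancelling it from the trivial two-mode cascade would make `G₁` trivial
as well. -/

namespace QuantumLinear

open Matrix
open scoped ComplexOrder

set_option linter.unusedSectionVars false

/-! ### Algebra of the operations `♭` and `#` -/

section Algebra

variable {κ ι μ ν : Type*} [Fintype κ] [DecidableEq κ] [Fintype ι] [DecidableEq ι]
  [Fintype μ] [DecidableEq μ] [Fintype ν] [DecidableEq ν]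

theorem mul_mul_of_mul_eq {X : Matrix κ ι ℂ} {Y : Matrix ι μ ℂ} {Z : Matrix κ μ ℂ}
    (h : X * Y = Z) (W : Matrix μ ν ℂ) : X * (Y * W) = Z * W := by
  rw [← Matrix.mul_assoc, h]

/-- The conjugation `Z ↦ Σ Z# Σ`, with `Σ` exchanging the two halves of the doubled-up vectors. Its
fixed points are the doubled-up matrices. -/
def sharp {κ ι : Type*} (Z : Matrix (κ ⊕ κ) (ι ⊕ ι) ℂ) : Matrix (κ ⊕ κ) (ι ⊕ ι) ℂ :=
  (Z.map star).submatrix Sum.swap Sum.swap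

@[simp] theorem sharp_doubleUp {κ ι : Type*} (X Y : Matrix κ ι ℂ) :
    sharp (doubleUp X Y) = doubleUp X Y := by
  ext i j
  rcases i with i | i <;> rcases j with j | j <;> simp [sharp, doubleUp]

theorem doubleUp_toBlocks {κ ι : Type*} {Z : Matrix (κ ⊕ κ) (ι ⊕ ι) ℂ} (h : sharp Z = Z) :
    doubleUp Z.toBlocks₁₁ Z.toBlocks₁₂ = Z := by
  ext i j
  have := congrFun (congrFun h i) j
  rcases i with i | i <;> rcases j with j | j <;>
    simp_all [sharp, doubleUp, toBlocks₁₁, toBlocks₁₂]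

@[simp] theorem sharp_sharp {κ ι : Type*} (Z : Matrix (κ ⊕ κ) (ι ⊕ ι) ℂ) :
    sharp (sharp Z) = Z := by
  ext; simp [sharp]

theorem sharp_mul (X : Matrix (κ ⊕ κ) (ι ⊕ ι) ℂ) (Y : Matrix (ι ⊕ ι) (μ ⊕ μ) ℂ) :
    sharp (X * Y) = sharp X * sharp Y := by
  have h : (X * Y).map star = X.map star * Y.map star := by
    ext i j
    simp [Matrix.mul_apply]
  rw [sharp, h]
  exact (submatrix_mul_equiv (X.map star) (Y.map star) Sum.swap (Equiv.sumComm ι ι) Sum.swap).symm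

@[simp] theorem sharp_add {κ ι : Type*} (X Y : Matrix (κ ⊕ κ) (ι ⊕ ι) ℂ) :
    sharp (X + Y) = sharp X + sharp Y := by
  ext; simp [sharp]

@[simp] theorem sharp_sub {κ ι : Type*} (X Y : Matrix (κ ⊕ κ) (ι ⊕ ι) ℂ) :
    sharp (X - Y) = sharp X - sharp Y := by
  ext; simp [sharp]

@[simp] theorem sharp_smul {κ ι : Type*} (c : ℂ) (X : Matrix (κ ⊕ κ) (ι ⊕ ι) ℂ) :
    sharp (c • X) = star c • sharp X := by
  ext; simp [sharp]

@[simp] theorem sharp_one : sharp (1 : Matrix (κ ⊕ κ) (κ ⊕ κ) ℂ) = 1 := by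
  ext i j
  rcases i with i | i <;> rcases j with j | j <;> simp [sharp, one_apply, apply_ite]

theorem sharp_J : sharp (J κ) = -J κ := by
  ext i j
  rcases i with i | i <;> rcases j with j | j <;> simp [sharp, J, one_apply, apply_ite]

theorem sharp_vac : sharp (vac κ) = 1 - vac κ := by
  ext i j
  rcases i with i | i <;> rcases j with j | j <;> simp [sharp, vac, one_apply]

@[simp] theorem J_mul_J : J κ * J κ = 1 := by
  simp [J, fromBlocks_multiply]

@[simp] theorem J_mul_J_mul (X : Matrix (κ ⊕ κ) ι ℂ) : J κ * (J κ * X) = X := by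
  rw [← Matrix.mul_assoc, J_mul_J, Matrix.one_mul]

@[simp] theorem conjTranspose_J : (J κ)ᴴ = J κ := by
  simp [J, fromBlocks_conjTranspose]

@[simp] theorem conjTranspose_vac : (vac κ)ᴴ = vac κ := by
  simp [vac, fromBlocks_conjTranspose]

@[simp] theorem vac_mul_vac : vac κ * vac κ = vac κ := by
  simp [vac, fromBlocks_multiply]

@[simp] theorem vac_mul_vac_mul (X : Matrix (κ ⊕ κ) ι ℂ) :
    vac κ * (vac κ * X) = vac κ * X := by
  rw [← Matrix.mul_assoc, vac_mul_vac]

@[simp] theorem vac_mul_J : vac κ * J κ = vac κ := by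
  simp [J, vac, fromBlocks_multiply]

@[simp] theorem J_mul_vac : J κ * vac κ = vac κ := by
  simp [J, vac, fromBlocks_multiply]

theorem one_add_J : 1 + J κ = (2 : ℂ) • vac κ := by
  ext i j
  rcases i with i | i <;> rcases j with j | j <;> simp [J, vac, one_apply]
  split_ifs <;> norm_num

theorem flat_mul (X : Matrix (κ ⊕ κ) (ι ⊕ ι) ℂ) (Y : Matrix (ι ⊕ ι) (μ ⊕ μ) ℂ) :
    flat (X * Y) = flat Y * flat X := by
  simp [flat, Matrix.mul_assoc]

@[simp] theorem flat_flat (X : Matrix (κ ⊕ κ) (ι ⊕ ι) ℂ) : flat (flat X) = X := by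
  simp [flat, Matrix.mul_assoc]

@[simp] theorem flat_add (X Y : Matrix (κ ⊕ κ) (ι ⊕ ι) ℂ) : flat (X + Y) = flat X + flat Y := by
  simp [flat, Matrix.mul_add, Matrix.add_mul]

@[simp] theorem flat_sub (X Y : Matrix (κ ⊕ κ) (ι ⊕ ι) ℂ) : flat (X - Y) = flat X - flat Y := by
  simp [flat, Matrix.mul_sub, Matrix.sub_mul]

@[simp] theorem flat_zero : flat (0 : Matrix (κ ⊕ κ) (ι ⊕ ι) ℂ) = 0 := by
  simp [flat]

@[simp] theorem flat_smul (c : ℂ) (X : Matrix (κ ⊕ κ) (ι ⊕ ι) ℂ) :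
    flat (c • X) = star c • flat X := by
  simp [flat]

@[simp] theorem flat_one : flat (1 : Matrix (κ ⊕ κ) (κ ⊕ κ) ℂ) = 1 := by
  simp [flat]

@[simp] theorem flat_vac : flat (vac κ) = vac κ := by
  simp [flat]

theorem conjTranspose_eq_flat (X : Matrix (κ ⊕ κ) (ι ⊕ ι) ℂ) : Xᴴ = J ι * flat X * J κ := by
  simp [flat, Matrix.mul_assoc]

theorem sharp_flat (X : Matrix (κ ⊕ κ) (ι ⊕ ι) ℂ) : sharp (flat X) = flat (sharp X) := by
  have h : sharp Xᴴ = (sharp X)ᴴ := by ext; simp [sharp]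
  rw [flat, sharp_mul, sharp_mul, sharp_J, sharp_J, h, flat]
  simp

theorem flat_inv (X : Matrix (κ ⊕ κ) (κ ⊕ κ) ℂ) {Y : Matrix (κ ⊕ κ) (κ ⊕ κ) ℂ} (h : X * Y = 1) :
    flat X * flat Y = 1 := by
  rw [← flat_mul, mul_eq_one_comm.1 h, flat_one]

end Algebra

/-! ### Pure covariances as projections -/

section VacProj

variable {κ ι μ : Type*} [Fintype κ] [DecidableEq κ] [Fintype ι] [DecidableEq ι]
  [Fintype μ] [DecidableEq μ]

/-- The projections `Q = P J` that belong to the covariance matrices `P` of pure states. -/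
structure IsPureProj (Q : Matrix (κ ⊕ κ) (κ ⊕ κ) ℂ) : Prop where
  mul_self : Q * Q = Q
  flat_eq : flat Q = Q
  sharp_eq : sharp Q = 1 - Q
  posSemidef : (Q * J κ).PosSemidef

theorem IsSymplectic.sharp_eq {S : Matrix (κ ⊕ κ) (κ ⊕ κ) ℂ} (h : IsSymplectic S) :
    sharp S = S := by
  obtain ⟨⟨X, Y, rfl⟩, -⟩ := h
  simp

theorem posSemidef_vac : (vac κ).PosSemidef := by
  have := posSemidef_conjTranspose_mul_self (vac κ)
  rwa [conjTranspose_vac, vac_mul_vac] at this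

/-- Since `S⁻¹ = S♭`, the matrix `P J` is `S⁻¹ V S`, and all four properties are inherited from `V`.
-/
theorem IsPureCov.isPureProj {P : Matrix (κ ⊕ κ) (κ ⊕ κ) ℂ} (h : IsPureCov P) :
    IsPureProj (P * J κ) := by
  obtain ⟨S, hS, hP⟩ := h
  obtain ⟨-, h₁, h₂⟩ := id hS
  have hQ : P * J κ = flat S * vac κ * S := by
    have e : flat S * (S * P * Sᴴ) * J κ * S = P * J κ := by
      rw [conjTranspose_eq_flat]
      simp only [Matrix.mul_assoc, mul_mul_of_mul_eq h₁, Matrix.one_mul, J_mul_J_mul, h₁,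
        Matrix.mul_one]
    rw [← e, hP, Matrix.mul_assoc _ (vac κ), vac_mul_J]
  have hc : P = flat S * vac κ * (flat S)ᴴ := by
    have : P = P * J κ * J κ := by simp [Matrix.mul_assoc]
    rw [this, hQ, conjTranspose_eq_flat, flat_flat]
    simp only [← Matrix.mul_assoc]
    rw [Matrix.mul_assoc _ (vac κ) (J κ), vac_mul_J]
  refine ⟨?_, ?_, ?_, ?_⟩
  · rw [hQ]
    simp only [Matrix.mul_assoc, mul_mul_of_mul_eq h₂, Matrix.one_mul, vac_mul_vac_mul]
  · simp [hQ, flat_mul, Matrix.mul_assoc]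
  · rw [hQ, sharp_mul, sharp_mul, sharp_flat, hS.sharp_eq, sharp_vac]
    simp [Matrix.mul_sub, Matrix.sub_mul, h₁]
  · rw [Matrix.mul_assoc, J_mul_J, Matrix.mul_one, hc]
    exact posSemidef_vac.mul_mul_conjTranspose_same _

theorem sharp_posSemidef {P : Matrix (κ ⊕ κ) (κ ⊕ κ) ℂ} (h : P.PosSemidef) :
    (sharp P).PosSemidef := by
  have : sharp P = Pᵀ.submatrix Sum.swap Sum.swap := by
    ext i j
    have := congrFun (congrFun h.isHermitian i.swap) j.swap
    simp only [conjTranspose_apply] at this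
    simp [sharp, ← this]
  rw [this]
  exact h.transpose.submatrix _

open scoped MatrixOrder in
-- The symmetrized covariance `H = (2Q - 1) J` is positive and symplectic, because `(2Q - 1)² = 1`.
-- Its positive square root `B` is symplectic too, and `B⁻¹` takes `Q J = (B² + J)/2` to `(1 +
-- J)/2`, the vacuum.
theorem IsPureProj.isPureCov {Q : Matrix (κ ⊕ κ) (κ ⊕ κ) ℂ} (h : IsPureProj Q) :
    IsPureCov (Q * J κ) := by
  set H : Matrix (κ ⊕ κ) (κ ⊕ κ) ℂ := Q * J κ + sharp (Q * J κ) with hH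
  have hHpos : H.PosSemidef := h.posSemidef.add (sharp_posSemidef h.posSemidef)
  have hHs : sharp H = H := by
    rw [hH, sharp_add, sharp_sharp, add_comm]
  have hH2 : H = (2 : ℂ) • (Q * J κ) - J κ := by
    rw [hH, sharp_mul, h.sharp_eq, sharp_J, two_smul]
    simp [Matrix.sub_mul]
    abel
  have hHJ : J κ * H * J κ * H = 1 := by
    have e : H = (2 * Q - 1) * J κ := by
      rw [hH2, two_mul, two_smul]
      noncomm_ring
    have e' : (2 * Q - 1) * (2 * Q - 1) = 1 := by
      have : (2 * Q - 1) * (2 * Q - 1) = 4 * (Q * Q) - 4 * Q + 1 := by noncomm_ring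
      rw [this, h.mul_self]
      simp
    rw [e]
    simp only [Matrix.mul_assoc, J_mul_J, Matrix.mul_one]
    rw [mul_mul_of_mul_eq e', Matrix.one_mul, J_mul_J]
  obtain ⟨B, hB, hBB⟩ : ∃ B : Matrix (κ ⊕ κ) (κ ⊕ κ) ℂ, B.PosSemidef ∧ B * B = H :=
    ⟨CFC.sqrt H, (CFC.sqrt_nonneg H).posSemidef, CFC.sqrt_mul_sqrt_self H hHpos.nonneg⟩
  -- Uniqueness of the positive square root passes the symmetries of `H` on to `B`.
  have uniq : ∀ B' : Matrix (κ ⊕ κ) (κ ⊕ κ) ℂ, B'.PosSemidef → B' * B' = H → B' = B := by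
    intro B' h' e'
    exact (CFC.mul_self_eq_mul_self_iff B' B h'.nonneg hB.nonneg).1 (e'.trans hBB.symm)
  have hBs : sharp B = B := uniq _ (sharp_posSemidef hB) (by rw [← sharp_mul, hBB, hHs])
  have hBu : IsUnit B.det := by
    have hHu : IsUnit H.det := isUnit_det_of_left_inverse hHJ
    rw [← hBB, det_mul] at hHu
    exact isUnit_of_mul_isUnit_left hHu
  have hinv : J κ * B⁻¹ * J κ = B := by
    apply uniq
    · have := hB.inv.mul_mul_conjTranspose_same (J κ)
      rwa [conjTranspose_J] at this
    · have e : B⁻¹ * B⁻¹ = J κ * H * J κ := by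
        rw [← Matrix.mul_inv_rev, hBB, inv_eq_left_inv hHJ]
      simp only [Matrix.mul_assoc, J_mul_J_mul]
      rw [mul_mul_of_mul_eq e]
      simp [Matrix.mul_assoc]
  have hJB : J κ * B * J κ = B⁻¹ := by
    conv_lhs => rw [← hinv]
    simp [Matrix.mul_assoc]
  have hfB : flat B = B⁻¹ := by rw [flat, hB.isHermitian.eq, hJB]
  refine ⟨flat B, ⟨⟨_, _, (doubleUp_toBlocks (by rw [sharp_flat, hBs])).symm⟩, ?_, ?_⟩, ?_⟩
  · rw [flat_flat, hfB, mul_nonsing_inv _ hBu]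
  · rw [flat_flat, hfB, nonsing_inv_mul _ hBu]
  · have hP : Q * J κ = (1 / 2 : ℂ) • (B * B + J κ) := by
      rw [hBB, hH2, sub_add_cancel, smul_smul]
      norm_num
    have hBH : (flat B)ᴴ = flat B := by
      rw [hfB, hB.inv.isHermitian.eq]
    have e : flat B * (B * B + J κ) * flat B = (2 : ℂ) • vac κ := by
      have e₁ : flat B * (B * B) * flat B = 1 := by
        rw [hfB, ← Matrix.mul_assoc, nonsing_inv_mul _ hBu, Matrix.one_mul, mul_nonsing_inv _ hBu]
      have e₂ : flat B * J κ * flat B = J κ := by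
        conv_lhs => rw [hfB, ← hJB]
        simp only [Matrix.mul_assoc, J_mul_J_mul]
        rw [← Matrix.mul_assoc (J κ) B (J κ), hJB, mul_nonsing_inv _ hBu, Matrix.mul_one]
      rw [Matrix.mul_add, Matrix.add_mul, e₁, e₂, one_add_J]
    rw [hBH, hP, Matrix.mul_smul, Matrix.smul_mul, e, smul_smul]
    norm_num

end VacProj

/-! ### Resolvents and spectra under intertwining -/

section Spectrum

variable {κ ι : Type*} [Fintype κ] [DecidableEq κ] [Fintype ι] [DecidableEq ι]

/-- Off the spectrum, the resolvent is a two-sided inverse. -/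
theorem resolvent_mul_inv {A : Matrix κ κ ℂ} {s : ℂ} (h : s ∉ spectrum ℂ A) :
    (s • (1 : Matrix κ κ ℂ) - A) * (s • (1 : Matrix κ κ ℂ) - A)⁻¹ = 1 := by
  rw [spectrum.notMem_iff, Algebra.algebraMap_eq_smul_one] at h
  exact mul_nonsing_inv _ ((isUnit_iff_isUnit_det _).1 h)

theorem inv_mul_resolvent {A : Matrix κ κ ℂ} {s : ℂ} (h : s ∉ spectrum ℂ A) :
    (s • (1 : Matrix κ κ ℂ) - A)⁻¹ * (s • (1 : Matrix κ κ ℂ) - A) = 1 :=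
  mul_eq_one_comm.1 (resolvent_mul_inv h)

theorem notMem_spectrum_of_mul_eq_one {A B : Matrix κ κ ℂ} {s : ℂ}
    (h : B * (s • (1 : Matrix κ κ ℂ) - A) = 1) : s ∉ spectrum ℂ A := by
  rw [spectrum.notMem_iff, Algebra.algebraMap_eq_smul_one, isUnit_iff_isUnit_det]
  exact isUnit_det_of_left_inverse h

/-- If `X` intertwines `B` with `A` and has a left inverse, the spectrum of `B` is contained in
that of `A`. -/
theorem spectrum_subset_of_intertwine {A : Matrix κ κ ℂ} {B : Matrix ι ι ℂ} {X : Matrix κ ι ℂ}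
    {Y : Matrix ι κ ℂ} (hYX : Y * X = 1) (h : A * X = X * B) : spectrum ℂ B ⊆ spectrum ℂ A := by
  intro s hs
  by_contra hA
  refine notMem_spectrum_of_mul_eq_one (B := Y * (s • (1 : Matrix κ κ ℂ) - A)⁻¹ * X) ?_ hs
  have e : X * (s • (1 : Matrix ι ι ℂ) - B) = (s • (1 : Matrix κ κ ℂ) - A) * X := by
    simp [Matrix.mul_sub, Matrix.sub_mul, h]
  rw [Matrix.mul_assoc, e, Matrix.mul_assoc, ← Matrix.mul_assoc _ _ X, inv_mul_resolvent hA,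
    Matrix.one_mul, hYX]

end Spectrum

/-! ### Changes of modes, power spectra and passivity -/

namespace QLS

variable {m : ℕ} {ι ι₁ ι₂ : Type} [Fintype ι] [DecidableEq ι] [Fintype ι₁] [DecidableEq ι₁]
  [Fintype ι₂] [DecidableEq ι₂]

@[simp] theorem sharp_C (G : QLS m ι) : sharp G.C = G.C := sharp_doubleUp _ _

@[simp] theorem sharp_A (G : QLS m ι) : sharp G.A = G.A := sharp_doubleUp _ _

theorem flat_A (G : QLS m ι) : flat G.A = -G.A - flat G.C * G.C := by
  have h : G.A + flat G.A + flat G.C * G.C = 0 := G.realizable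
  rw [eq_sub_iff_add_eq, eq_neg_iff_add_eq_zero, ← h]
  abel

/-- The system with coupling matrix `C W` and system matrix `W♭ A W`. For symplectic `W` this is a
change of modes. -/
def pull (G : QLS m ι) (W : Matrix (ι ⊕ ι) (ι₁ ⊕ ι₁) ℂ) (hW : sharp W = W) : QLS m ι₁ where
  Cminus := (G.C * W).toBlocks₁₁
  Cplus := (G.C * W).toBlocks₁₂
  Aminus := (flat W * G.A * W).toBlocks₁₁
  Aplus := (flat W * G.A * W).toBlocks₁₂
  -- `♭` commutes with `X ↦ W♭ X W`, so the condition for `G` is merely compressed by `W`; isometry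
  -- of `W` plays no role.
  realizable := by
    rw [doubleUp_toBlocks (by simp [sharp_mul, sharp_flat, hW]),
      doubleUp_toBlocks (by simp [sharp_mul, hW])]
    simp only [flat_mul, flat_flat, flat_A, Matrix.mul_sub, Matrix.sub_mul, Matrix.mul_assoc,
      Matrix.neg_mul, Matrix.mul_neg]
    abel

theorem pull_C (G : QLS m ι) (W : Matrix (ι ⊕ ι) (ι₁ ⊕ ι₁) ℂ) (hW : sharp W = W) :
    (G.pull W hW).C = G.C * W :=
  doubleUp_toBlocks (by simp [sharp_mul, hW])

theorem pull_A (G : QLS m ι) (W : Matrix (ι ⊕ ι) (ι₁ ⊕ ι₁) ℂ) (hW : sharp W = W) :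
    (G.pull W hW).A = flat W * G.A * W :=
  doubleUp_toBlocks (by simp [sharp_mul, sharp_flat, hW])

theorem transfer_pull (G : QLS m ι) (W : Matrix (ι ⊕ ι) (ι₁ ⊕ ι₁) ℂ) (hW : sharp W = W)
    (h₁ : flat W * W = 1) (h₂ : W * flat W = 1) {s : ℂ} (hs : s ∉ spectrum ℂ G.A) :
    (G.pull W hW).transfer s = G.transfer s := by
  have e : (s • (1 : Matrix (ι₁ ⊕ ι₁) (ι₁ ⊕ ι₁) ℂ) - flat W * G.A * W)⁻¹
      = flat W * (s • (1 : Matrix (ι ⊕ ι) (ι ⊕ ι) ℂ) - G.A)⁻¹ * W := by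
    apply inv_eq_left_inv
    have : s • (1 : Matrix (ι₁ ⊕ ι₁) (ι₁ ⊕ ι₁) ℂ) - flat W * G.A * W
        = flat W * (s • (1 : Matrix (ι ⊕ ι) (ι ⊕ ι) ℂ) - G.A) * W := by
      simp [Matrix.mul_sub, Matrix.sub_mul, h₁]
    rw [this]
    simp only [Matrix.mul_assoc]
    rw [mul_mul_of_mul_eq h₂, Matrix.one_mul, mul_mul_of_mul_eq (inv_mul_resolvent hs),
      Matrix.one_mul, h₁]
  rw [transfer, pull_C, pull_A, e, transfer, flat_mul]
  simp only [Matrix.mul_assoc, mul_mul_of_mul_eq h₂, Matrix.one_mul]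

/-- Realizability says `C♭C = (s - A) + (-s* - A)♭`, so the quadratic term in the product splits
into the two linear ones. -/
theorem transfer_mul_flat (G : QLS m ι) {s : ℂ} (hs : G.IsRegularAt s) :
    G.transfer s * flat (G.transfer (-star s)) = 1 := by
  set R := (s • (1 : Matrix (ι ⊕ ι) (ι ⊕ ι) ℂ) - G.A) with hR
  set R' := (-star s • (1 : Matrix (ι ⊕ ι) (ι ⊕ ι) ℂ) - G.A) with hR'
  have h₁ : R⁻¹ * R = 1 := inv_mul_resolvent hs.1
  have h₂ : flat R' * flat R'⁻¹ = 1 := flat_inv _ (resolvent_mul_inv hs.2)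
  have h₃ : flat G.C * G.C = R + flat R' := by
    rw [hR, hR', flat_sub, flat_smul, flat_one, flat_A, star_neg, star_star, neg_smul]
    abel
  have h₄ : R⁻¹ * (flat G.C * G.C) * flat R'⁻¹ = flat R'⁻¹ + R⁻¹ := by
    rw [h₃, Matrix.mul_add, Matrix.add_mul, h₁, Matrix.one_mul, Matrix.mul_assoc, h₂,
      Matrix.mul_one]
  rw [transfer, transfer, flat_sub, flat_one, flat_mul, flat_mul, flat_flat]
  have h₅ : G.C * R⁻¹ * flat G.C * (G.C * (flat R'⁻¹ * flat G.C))
      = G.C * (R⁻¹ * (flat G.C * G.C) * flat R'⁻¹) * flat G.C := by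
    simp only [Matrix.mul_assoc]
  rw [Matrix.sub_mul, Matrix.mul_sub, Matrix.mul_sub, Matrix.one_mul, Matrix.mul_one, Matrix.one_mul,
    h₅, h₄, Matrix.mul_add, Matrix.add_mul]
  simp only [Matrix.mul_assoc]
  abel

theorem powerSpectrum_eq (G : QLS m ι) (s : ℂ) :
    G.powerSpectrum s = G.transfer s * vac (Fin m) * flat (G.transfer (-star s)) * J (Fin m) := by
  rw [powerSpectrum, conjTranspose_eq_flat]
  simp only [← Matrix.mul_assoc]
  rw [Matrix.mul_assoc _ (vac _) (J _), vac_mul_J]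

/-- `Ξ(-s*)♭` is the inverse of `Ξ(s)`, so up to a factor `J` the power spectrum is the conjugate of
`V` by `Ξ(s)`. -/
theorem powerSpectrum_eq_vac_iff (G : QLS m ι) {s : ℂ} (hs : G.IsRegularAt s) :
    G.powerSpectrum s = vac (Fin m) ↔ G.transfer s * vac (Fin m) = vac (Fin m) * G.transfer s := by
  have h₁ := G.transfer_mul_flat hs
  have h₂ := mul_eq_one_comm.1 h₁
  rw [powerSpectrum_eq]
  constructor
  · intro h
    have h' : G.transfer s * vac (Fin m) * flat (G.transfer (-star s)) = vac (Fin m) := by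
      have := congrArg (· * J (Fin m)) h
      simpa only [Matrix.mul_assoc, J_mul_J, Matrix.mul_one, vac_mul_J] using this
    nth_rw 2 [← h']
    rw [Matrix.mul_assoc _ _ (G.transfer s), h₂, Matrix.mul_one]
  · intro h
    rw [h, Matrix.mul_assoc (vac _), h₁, Matrix.mul_one, vac_mul_J]

/-- The projection `Q` reduces the system and is carried by the coupling to the vacuum projection
of the fields: in the modes in which `Q` is the vacuum projection, the system is passive. -/
def IsPassiveFor (G : QLS m ι) (Q : Matrix (ι ⊕ ι) (ι ⊕ ι) ℂ) : Prop :=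
  G.A * Q = Q * G.A ∧ G.C * Q = vac (Fin m) * G.C

/-- Multiplication by `J` turns `A†` into `A♭ = -A - C♭C`, so that a commutator with `A` appears. -/
theorem isStationaryCov_iff (G : QLS m ι) (Q : Matrix (ι ⊕ ι) (ι ⊕ ι) ℂ) :
    G.IsStationaryCov (Q * J ι) ↔
      G.A * Q - Q * G.A - Q * (flat G.C * G.C) + flat G.C * vac (Fin m) * G.C = 0 := by
  have e : G.A * (Q * J ι) + Q * J ι * G.Aᴴ + flat G.C * vac (Fin m) * (flat G.C)ᴴ
      = (G.A * Q - Q * G.A - Q * (flat G.C * G.C) + flat G.C * vac (Fin m) * G.C) * J ι := by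
    have e₁ : vac (Fin m) * (flat G.C)ᴴ = vac (Fin m) * G.C * J ι := by
      rw [conjTranspose_eq_flat, flat_flat]
      simp only [← Matrix.mul_assoc, vac_mul_J]
    rw [Matrix.mul_assoc (flat G.C), e₁, conjTranspose_eq_flat, flat_A]
    simp only [Matrix.add_mul, Matrix.sub_mul, Matrix.mul_sub, Matrix.mul_assoc, J_mul_J_mul,
      Matrix.neg_mul, Matrix.mul_neg]
    abel
  rw [IsStationaryCov, e]
  constructor
  · intro h
    have := congrArg (· * J ι) h
    simpa only [Matrix.mul_assoc, J_mul_J, Matrix.mul_one, Matrix.zero_mul] using this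
  · intro h
    rw [h, Matrix.zero_mul]

theorem IsPassiveFor.flat_C {G : QLS m ι} {Q : Matrix (ι ⊕ ι) (ι ⊕ ι) ℂ} (hQ : flat Q = Q)
    (h : G.IsPassiveFor Q) : Q * flat G.C = flat G.C * vac (Fin m) := by
  have := congrArg flat h.2
  rwa [flat_mul, flat_mul, hQ, flat_vac] at this

theorem IsPassiveFor.isStationaryCov {G : QLS m ι} {Q : Matrix (ι ⊕ ι) (ι ⊕ ι) ℂ}
    (hQ : flat Q = Q) (h : G.IsPassiveFor Q) : G.IsStationaryCov (Q * J ι) := by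
  rw [isStationaryCov_iff, h.1, ← Matrix.mul_assoc Q, h.flat_C hQ]
  abel

theorem IsPassiveFor.hasPureStationaryState {G : QLS m ι} {Q : Matrix (ι ⊕ ι) (ι ⊕ ι) ℂ}
    (hQ : IsPureProj Q) (h : G.IsPassiveFor Q) : G.HasPureStationaryState :=
  ⟨_, h.isStationaryCov hQ.flat_eq, hQ.isPureCov⟩

/-- Compression by `1 - Q` leaves only the noise term, which up to `J` has the form `X†X` and so
forces `X = VC(1 - Q) = 0`. Applying `#` gives the companion `(1 - V)CQ = 0`. Together they say `CQ
= VC`, and the noise terms then cancel, leaving the commutator. Positivity of `Q J` is not needed.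
-/
theorem isPassiveFor_of_isStationaryCov {G : QLS m ι} {Q : Matrix (ι ⊕ ι) (ι ⊕ ι) ℂ}
    (hm : Q * Q = Q) (hf : flat Q = Q) (hs : sharp Q = 1 - Q)
    (h : G.IsStationaryCov (Q * J ι)) : G.IsPassiveFor Q := by
  rw [isStationaryCov_iff] at h
  have hQ' : (1 - Q) * Q = 0 := by simp [Matrix.sub_mul, hm]
  have hQ'' : Q * (1 - Q) = 0 := by simp [Matrix.mul_sub, hm]
  have key : (1 - Q) * (flat G.C * vac (Fin m) * G.C) * (1 - Q) = 0 := by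
    have := congrArg (fun X => (1 - Q) * X * (1 - Q)) h
    simp only [Matrix.mul_zero, Matrix.zero_mul] at this
    rw [← this]
    simp only [Matrix.mul_add, Matrix.mul_sub (1 - Q), Matrix.add_mul, Matrix.sub_mul _ _ (1 - Q)]
    simp only [Matrix.mul_assoc, hQ'', mul_mul_of_mul_eq hQ', Matrix.mul_zero, Matrix.zero_mul]
    simp
  set X := vac (Fin m) * G.C * (1 - Q) with hX
  have hX0 : X = 0 := by
    have e : Xᴴ * X = J ι * ((1 - Q) * (flat G.C * vac (Fin m) * G.C) * (1 - Q)) := by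
      rw [conjTranspose_eq_flat, hX, flat_mul, flat_mul, flat_vac, flat_sub, flat_one, hf]
      simp only [Matrix.mul_assoc]
      rw [mul_mul_of_mul_eq J_mul_vac, vac_mul_vac_mul]
    rw [key, Matrix.mul_zero] at e
    exact conjTranspose_mul_self_eq_zero.1 e
  have hX1 : vac (Fin m) * G.C * Q = vac (Fin m) * G.C := by
    rw [hX, Matrix.mul_sub, Matrix.mul_one, sub_eq_zero] at hX0
    exact hX0.symm
  have hX2 : G.C * Q = vac (Fin m) * G.C * Q := by
    have := congrArg sharp hX1
    simp only [sharp_mul, sharp_vac, sharp_C, hs] at this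
    simp only [Matrix.mul_sub, Matrix.sub_mul, Matrix.mul_one, Matrix.one_mul] at this
    rw [sub_eq_self, sub_eq_zero] at this
    exact this
  have hC : G.C * Q = vac (Fin m) * G.C := hX2.trans hX1
  have hC' := congrArg flat hC
  rw [flat_mul, flat_mul, hf, flat_vac] at hC'
  rw [← Matrix.mul_assoc, hC', sub_add_cancel, sub_eq_zero] at h
  exact ⟨h, hC⟩

/-- `V` moves through `C (s - A)⁻¹ C♭` by becoming `Q` between the two couplings, where it commutes
with the resolvent. -/
theorem IsPassiveFor.hasTrivialPowerSpectrum {G : QLS m ι} {Q : Matrix (ι ⊕ ι) (ι ⊕ ι) ℂ}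
    (hf : flat Q = Q) (h : G.IsPassiveFor Q) : G.HasTrivialPowerSpectrum := by
  intro s hs
  rw [powerSpectrum_eq_vac_iff G hs, transfer]
  set R := (s • (1 : Matrix (ι ⊕ ι) (ι ⊕ ι) ℂ) - G.A) with hR
  have hRQ : R * Q = Q * R := by simp [hR, Matrix.sub_mul, Matrix.mul_sub, h.1]
  have hR₁ : R * R⁻¹ = 1 := resolvent_mul_inv hs.1
  have hR₂ : R⁻¹ * R = 1 := inv_mul_resolvent hs.1
  have hRQ' : R⁻¹ * Q = Q * R⁻¹ := by
    calc R⁻¹ * Q = R⁻¹ * (Q * R) * R⁻¹ := by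
          rw [Matrix.mul_assoc, Matrix.mul_assoc, hR₁, Matrix.mul_one]
      _ = Q * R⁻¹ := by rw [← hRQ, ← Matrix.mul_assoc, hR₂, Matrix.one_mul]
  rw [Matrix.sub_mul, Matrix.mul_sub, Matrix.one_mul, Matrix.mul_one, Matrix.mul_assoc,
    ← h.flat_C hf, ← Matrix.mul_assoc, Matrix.mul_assoc _ _ Q, hRQ', ← Matrix.mul_assoc, h.2]
  simp only [Matrix.mul_assoc]

/-- The condition `hQ` expresses that `Q` does not lead out of the range of `W`; its `♭` gives the
same for the complementary modes. -/
theorem IsPassiveFor.pull {G : QLS m ι} {Q : Matrix (ι ⊕ ι) (ι ⊕ ι) ℂ} (hf : flat Q = Q)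
    (h : G.IsPassiveFor Q) {W : Matrix (ι ⊕ ι) (ι₁ ⊕ ι₁) ℂ} (hW : sharp W = W)
    (hQ : W * flat W * Q * W = Q * W) : (G.pull W hW).IsPassiveFor (flat W * Q * W) := by
  have hQ' := congrArg flat hQ
  simp only [flat_mul, flat_flat, hf] at hQ'
  simp only [Matrix.mul_assoc] at hQ hQ'
  constructor
  · simp only [pull_A, Matrix.mul_assoc, hQ]
    rw [mul_mul_of_mul_eq h.1, Matrix.mul_assoc, ← Matrix.mul_assoc W (flat W),
      ← Matrix.mul_assoc Q (W * flat W), ← Matrix.mul_assoc (flat W) (Q * (W * flat W)), hQ']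
    simp only [Matrix.mul_assoc]
  · simp only [pull_C, Matrix.mul_assoc, hQ]
    simp only [← Matrix.mul_assoc, h.2]

end QLS

theorem IsPureProj.pull {κ ι : Type*} [Fintype κ] [DecidableEq κ] [Fintype ι] [DecidableEq ι]
    {Q : Matrix (κ ⊕ κ) (κ ⊕ κ) ℂ} (h : IsPureProj Q) {W : Matrix (κ ⊕ κ) (ι ⊕ ι) ℂ}
    (hW : sharp W = W) (hWW : flat W * W = 1) (hQ : W * flat W * Q * W = Q * W) :
    IsPureProj (flat W * Q * W) := by
  refine ⟨?_, ?_, ?_, ?_⟩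
  · simp only [Matrix.mul_assoc] at hQ ⊢
    rw [hQ, mul_mul_of_mul_eq h.mul_self]
  · simp only [flat_mul, flat_flat, h.flat_eq, Matrix.mul_assoc]
  · simp only [sharp_mul, sharp_flat, hW, h.sharp_eq, Matrix.mul_sub, Matrix.sub_mul, Matrix.mul_one,
      hWW]
  · have := h.posSemidef.mul_mul_conjTranspose_same (flat W)
    rw [conjTranspose_eq_flat, flat_flat] at this
    simpa only [Matrix.mul_assoc, J_mul_J_mul] using this

/-! ### Inclusions of sets of modes -/

section Incl

variable {κ ι μ ν : Type*} [Fintype κ] [DecidableEq κ] [Fintype ι] [DecidableEq ι]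
  [Fintype μ] [DecidableEq μ] [Fintype ν] [DecidableEq ν]

/-- The doubled-up inclusion of the modes `ι` into the modes `κ` along a map of the labels. -/
def incl (f : ι → κ) : Matrix (κ ⊕ κ) (ι ⊕ ι) ℂ :=
  (1 : Matrix (κ ⊕ κ) (κ ⊕ κ) ℂ).submatrix id (Sum.map f f)

theorem incl_eq_doubleUp (f : ι → κ) :
    incl f = doubleUp ((1 : Matrix κ κ ℂ).submatrix id f) 0 := by
  ext i j
  rcases i with i | i <;> rcases j with j | j <;> simp [doubleUp, incl, one_apply, apply_ite]

@[simp] theorem sharp_incl (f : ι → κ) : sharp (incl f) = incl f := by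
  ext i j
  rcases i with i | i <;> rcases j with j | j <;> simp [sharp, incl, one_apply, apply_ite]

theorem mul_incl (X : Matrix ν (κ ⊕ κ) ℂ) (f : ι → κ) :
    X * incl f = X.submatrix id (Sum.map f f) := by
  exact mul_submatrix_one (Equiv.refl _) _ X

theorem flat_incl (f : ι → κ) :
    flat (incl f) = (1 : Matrix (κ ⊕ κ) (κ ⊕ κ) ℂ).submatrix (Sum.map f f) id := by
  rw [incl_eq_doubleUp, flat_doubleUp]
  ext i j
  rcases i with i | i <;> rcases j with j | j <;> simp [doubleUp, one_apply, apply_ite, eq_comm]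

theorem flat_incl_mul (f : ι → κ) (X : Matrix (κ ⊕ κ) ν ℂ) :
    flat (incl f) * X = X.submatrix (Sum.map f f) id := by
  rw [flat_incl]
  exact one_submatrix_mul _ (Equiv.refl _) X

theorem flat_incl_mul_incl_self {f : ι → κ} (hf : Function.Injective f) :
    flat (incl f) * incl f = 1 := by
  rw [flat_incl_mul, incl, submatrix_submatrix]
  exact submatrix_one _ (Sum.map_injective.2 ⟨hf, hf⟩)

theorem flat_incl_mul_incl_of_disjoint {f : ι → κ} {g : μ → κ} (h : ∀ i j, f i ≠ g j) :
    flat (incl f) * incl g = 0 := by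
  rw [flat_incl_mul]
  ext i j
  rcases i with i | i <;> rcases j with j | j <;> simp [incl, one_apply, h]

theorem incl_mul_flat_add (e : ι ⊕ μ ≃ κ) :
    incl (e ∘ Sum.inl) * flat (incl (e ∘ Sum.inl)) + incl (e ∘ Sum.inr) * flat (incl (e ∘ Sum.inr))
      = 1 := by
  have key : (1 : Matrix κ κ ℂ).submatrix id (e ∘ Sum.inl)
        * ((1 : Matrix κ κ ℂ).submatrix id (e ∘ Sum.inl))ᴴ
      + (1 : Matrix κ κ ℂ).submatrix id (e ∘ Sum.inr)
        * ((1 : Matrix κ κ ℂ).submatrix id (e ∘ Sum.inr))ᴴ = 1 := by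
    have h : (1 : Matrix κ κ ℂ) * 1ᴴ = 1 := by simp
    ext i j
    rw [← congrFun (congrFun h i) j, Matrix.mul_apply, ← e.sum_comp, Fintype.sum_sum_type]
    rfl
  rw [incl_eq_doubleUp, incl_eq_doubleUp, flat_doubleUp, flat_doubleUp, doubleUp_mul, doubleUp_mul,
    doubleUp_add]
  simp only [transpose_zero, neg_zero, Matrix.mul_zero, Matrix.zero_mul, add_zero, key]
  ext i j
  rcases i with i | i <;> rcases j with j | j <;>
    simp [doubleUp, one_apply, apply_ite, Matrix.map_zero]

end Incl

/-! ### Symplectic completion and one-mode computations -/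

section Completion

variable {κ ι μ : Type*} [Fintype κ] [DecidableEq κ] [Fintype ι] [DecidableEq ι]
  [Fintype μ] [DecidableEq μ]

/-- Two isometric doubled-up matrices are related by a Householder-type symplectic matrix. -/
theorem exists_symplectic_mul_eq {U E : Matrix (κ ⊕ κ) (ι ⊕ ι) ℂ} (hU : sharp U = U)
    (hE : sharp E = E) (hUU : flat U * U = 1) (hEE : flat E * E = 1)
    {K : Matrix (ι ⊕ ι) (ι ⊕ ι) ℂ} (hK : K * (1 - flat U * E) = 1) :
    ∃ T : Matrix (κ ⊕ κ) (κ ⊕ κ) ℂ, sharp T = T ∧ flat T * T = 1 ∧ T * E = U := by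
  set N := 1 - flat U * E with hN
  have hK' : N * K = 1 := mul_eq_one_comm.1 hK
  have hKf : flat N * flat K = 1 := flat_inv _ hK'
  have hKf' : flat K * flat N = 1 := mul_eq_one_comm.1 hKf
  have hNs : sharp N = N := by simp [hN, sharp_mul, sharp_flat, hU, hE]
  have hKs : sharp K = K := by
    have : sharp K * N = 1 := by
      rw [← hNs, ← sharp_mul, hK, sharp_one]
    calc sharp K = sharp K * (N * K) := by rw [hK', Matrix.mul_one]
      _ = K := by rw [← Matrix.mul_assoc, this, Matrix.one_mul]
  set D := U - E with hD
  have hDs : sharp D = D := by simp [hD, hU, hE]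
  have hDE : flat D * E = -N := by
    rw [hD, hN, flat_sub, Matrix.sub_mul, hEE]
    abel
  have hDD : flat D * D = N + flat N := by
    rw [hD, hN]
    simp only [flat_sub, flat_one, flat_mul, flat_flat, Matrix.sub_mul, Matrix.mul_sub, hEE, hUU]
    abel
  refine ⟨1 - D * K * flat D, ?_, ?_, ?_⟩
  · simp [sharp_mul, sharp_flat, hDs, hKs]
  · have e : flat K * (flat D * D) * K = flat K + K := by
      rw [hDD, Matrix.mul_add, Matrix.add_mul, Matrix.mul_assoc, hK', hKf', Matrix.mul_one,
        Matrix.one_mul]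
    have e' : flat (1 - D * K * flat D) * (1 - D * K * flat D)
        = 1 - D * K * flat D - D * flat K * flat D
          + D * (flat K * (flat D * D) * K) * flat D := by
      simp only [flat_sub, flat_one, flat_mul, flat_flat, Matrix.sub_mul, Matrix.mul_sub,
        Matrix.mul_assoc, Matrix.one_mul, Matrix.mul_one]
      abel
    rw [e', e, Matrix.mul_add, Matrix.add_mul]
    abel
  · rw [Matrix.sub_mul, Matrix.mul_assoc, hDE, Matrix.mul_neg, Matrix.mul_assoc, hK,
      Matrix.mul_one, Matrix.one_mul, hD]
    abel

/-- Equality at `ω = ±1` would force `Re a = 0`, and at `ω = ±i` it would force `Im a = 0`. The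
freedom of phase serves to make `1 - U♭E` invertible. -/
theorem exists_phase {a : ℂ} (ha : a ≠ 0) (c : ℝ) :
    ∃ ω : ℂ, star ω * ω = 1 ∧ Complex.normSq (1 - star ω * a) ≠ c := by
  by_contra! h
  have h₁ := h 1 (by simp)
  have h₂ := h (-1) (by simp)
  have h₃ := h Complex.I (by simp)
  have h₄ := h (-Complex.I) (by simp)
  simp [Complex.normSq_apply] at h₁ h₂ h₃ h₄
  exact ha (Complex.ext (by simp; linarith) (by simp; linarith))

/-- For a single mode this gives an explicit inverse, a multiple of `N♭`, as soon as the two moduli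
differ. -/
theorem flat_mul_self_of_oneMode {N : Matrix (Fin 1 ⊕ Fin 1) (Fin 1 ⊕ Fin 1) ℂ}
    (h : sharp N = N) :
    flat N * N = ((Complex.normSq (N (.inl 0) (.inl 0)) -
      Complex.normSq (N (.inl 0) (.inr 0)) : ℝ) : ℂ) • 1 := by
  rw [← doubleUp_toBlocks h, flat_doubleUp, doubleUp_mul]
  ext i j
  rcases i with i | i <;> rcases j with j | j <;>
    simp [doubleUp, Matrix.mul_apply, toBlocks₁₁, toBlocks₁₂, Fin.fin_one_eq_zero,
      Complex.normSq_eq_conj_mul_self] <;> ring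

/-- A symplectic pair of vectors can be completed to a symplectic matrix. -/
theorem exists_symplectic_completion {r : ℕ} {U : Matrix (Fin r ⊕ Fin r) (Fin 1 ⊕ Fin 1) ℂ}
    (hU : sharp U = U) (hUU : flat U * U = 1) :
    ∃ k : ℕ, r = k + 1 ∧ ∃ W : Matrix (Fin r ⊕ Fin r) (Fin k ⊕ Fin k) ℂ,
      sharp W = W ∧ flat W * W = 1 ∧ flat U * W = 0 ∧ U * flat U + W * flat W = 1 := by
  -- The first column of `U` has `J`-norm `1`, so its upper half, the only positive contribution,
  -- cannot vanish.
  obtain ⟨j, hj⟩ : ∃ j, U (.inl j) (.inl 0) ≠ 0 := by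
    by_contra! h
    have e := congrFun (congrFun hUU (.inl 0)) (.inl 0)
    have e' := congrArg Complex.re e
    simp [flat, J, Matrix.mul_apply, fromBlocks, one_apply, h] at e'
    have : 0 ≤ ∑ x, ((U (.inr x) (.inl 0)).re * (U (.inr x) (.inl 0)).re
        + (U (.inr x) (.inl 0)).im * (U (.inr x) (.inl 0)).im) :=
      Finset.sum_nonneg fun x _ => add_nonneg (mul_self_nonneg _) (mul_self_nonneg _)
    linarith
  obtain ⟨k, rfl⟩ : ∃ k, r = k + 1 := ⟨r - 1, by have := j.pos; omega⟩
  refine ⟨k, rfl, ?_⟩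
  -- The swap makes `E` the inclusion of mode `j`, where `U` has a nonzero entry.
  let e : Fin 1 ⊕ Fin k ≃ Fin (k + 1) :=
    (finSumFinEquiv.trans (finCongr (add_comm 1 k))).trans (Equiv.swap 0 j)
  have he : e (.inl 0) = j := by
    have : (finCongr (add_comm 1 k)) (finSumFinEquiv (.inl 0)) = 0 := by
      ext; simp
    simp only [e, Equiv.trans_apply, this, Equiv.swap_apply_left]
  set E := incl (e ∘ Sum.inl) with hE
  set E' := incl (e ∘ Sum.inr) with hE'
  have hEE : flat E * E = 1 := flat_incl_mul_incl_self (e.injective.comp Sum.inl_injective)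
  have hEE' : flat E' * E' = 1 := flat_incl_mul_incl_self (e.injective.comp Sum.inr_injective)
  have hE0 : flat E * E' = 0 := flat_incl_mul_incl_of_disjoint (by simp)
  have hE1 : E * flat E + E' * flat E' = 1 := incl_mul_flat_add e
  set M := flat U * E with hM
  have hMa : M (.inl 0) (.inl 0) ≠ 0 := by
    rw [hM, hE, mul_incl]
    simpa [he, flat, J, Matrix.mul_apply, fromBlocks, one_apply] using hj
  -- Replacing `U` by `U g`, with `g` the rotation by `ω`, keeps `U U♭` and makes the Householder
  -- matrix available.
  obtain ⟨ω, hω, hne⟩ := exists_phase hMa (Complex.normSq (M (.inl 0) (.inr 0)))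
  set g : Matrix (Fin 1 ⊕ Fin 1) (Fin 1 ⊕ Fin 1) ℂ := doubleUp (ω • 1) 0 with hg
  have hgs : sharp g = g := sharp_doubleUp _ _
  have hgf : flat g = doubleUp (star ω • 1) 0 := by
    rw [hg, flat_doubleUp]; simp
  have hgg : flat g * g = 1 := by
    rw [hgf, hg, doubleUp_mul]
    ext i j
    rcases i with i | i <;> rcases j with j | j <;>
      simp [doubleUp, one_apply, Fin.fin_one_eq_zero] <;> simpa [mul_comm] using hω
  have hgg' : g * flat g = 1 := mul_eq_one_comm.1 hgg
  have hUg : flat (U * g) * (U * g) = 1 := by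
    rw [flat_mul, Matrix.mul_assoc, mul_mul_of_mul_eq hUU, Matrix.one_mul, hgg]
  have hUgs : sharp (U * g) = U * g := by rw [sharp_mul, hU, hgs]
  set N := 1 - flat (U * g) * E with hN
  have hNM : N = 1 - flat g * M := by rw [hN, hM, flat_mul, Matrix.mul_assoc]
  have hNs : sharp N = N := by simp [hN, sharp_mul, sharp_flat, hU, hgs, hE]
  have hNN := flat_mul_self_of_oneMode hNs
  set d : ℝ := Complex.normSq (N (.inl 0) (.inl 0)) - Complex.normSq (N (.inl 0) (.inr 0)) with hd
  have hd0 : (d : ℂ) ≠ 0 := by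
    have e₁ : N (.inl 0) (.inl 0) = 1 - star ω * M (.inl 0) (.inl 0) := by
      simp [hNM, hgf, doubleUp, Matrix.mul_apply]
    have e₂ : N (.inl 0) (.inr 0) = -(star ω * M (.inl 0) (.inr 0)) := by
      simp [hNM, hgf, doubleUp, Matrix.mul_apply]
    have e₃ : Complex.normSq (star ω) = 1 := by
      have : ((Complex.normSq ω : ℝ) : ℂ) = 1 := by
        rw [Complex.normSq_eq_conj_mul_self]; exact hω
      have : Complex.normSq ω = 1 := by exact_mod_cast this
      rw [← this]
      exact Complex.normSq_conj ω
    rw [hd, e₁, e₂, Complex.normSq_neg, Complex.normSq_mul, e₃, one_mul]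
    exact_mod_cast sub_ne_zero.2 hne
  have hK : ((d : ℂ)⁻¹ • flat N) * N = 1 := by
    rw [Matrix.smul_mul, hNN, smul_smul, inv_mul_cancel₀ hd0, one_smul]
  obtain ⟨T, hTs, hTT, hTE⟩ := exists_symplectic_mul_eq hUgs (sharp_incl _) hUg hEE hK
  have hTT' : T * flat T = 1 := mul_eq_one_comm.1 hTT
  refine ⟨T * E', by rw [sharp_mul, hTs, hE', sharp_incl], ?_, ?_, ?_⟩
  · rw [flat_mul, Matrix.mul_assoc, mul_mul_of_mul_eq hTT, Matrix.one_mul, hEE']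
  · have : flat (U * g) * (T * E') = 0 := by
      rw [← hTE, flat_mul, Matrix.mul_assoc, mul_mul_of_mul_eq hTT, Matrix.one_mul, hE0]
    calc flat U * (T * E') = g * (flat (U * g) * (T * E')) := by
          rw [flat_mul, Matrix.mul_assoc, mul_mul_of_mul_eq hgg', Matrix.one_mul]
      _ = 0 := by rw [this, Matrix.mul_zero]
  · have : U * flat U = T * (E * flat E) * flat T := by
      calc U * flat U = (U * g) * flat (U * g) := by
            rw [flat_mul, Matrix.mul_assoc, mul_mul_of_mul_eq hgg', Matrix.one_mul]
        _ = T * (E * flat E) * flat T := by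
            rw [← hTE, flat_mul, ← hE]
            simp only [Matrix.mul_assoc]
    have h' : T * E' * flat (T * E') = T * (E' * flat E') * flat T := by
      rw [flat_mul]
      simp only [Matrix.mul_assoc]
    rw [this, h', ← Matrix.add_mul, ← Matrix.mul_add, hE1, Matrix.mul_one, hTT']

/-- The symmetries force trace `1`, so by Cayley–Hamilton `Q² - Q = -det Q = det (Q J)`, which is
nonnegative. Thus `δ` measures how far a one-mode state is from pure. -/
theorem exists_mul_self_sub_of_oneMode {Q : Matrix (Fin 1 ⊕ Fin 1) (Fin 1 ⊕ Fin 1) ℂ}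
    (hf : flat Q = Q) (hs : sharp Q = 1 - Q) (hp : (Q * J (Fin 1)).PosSemidef) :
    ∃ δ : ℝ, 0 ≤ δ ∧ Q * Q - Q = (δ : ℂ) • 1 := by
  have hdet := (hp.submatrix ![.inl 0, .inr 0]).det_nonneg
  obtain ⟨δ, hδ⟩ : ∃ δ : ℝ, (δ : ℂ) = ((Q * J (Fin 1)).submatrix ![.inl 0, .inr 0]
      ![.inl 0, .inr 0]).det := ⟨_, (Complex.eq_re_of_ofReal_le hdet).symm⟩
  refine ⟨δ, by rw [← hδ] at hdet; exact_mod_cast hdet, ?_⟩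
  rw [hδ, det_fin_two]
  have h₁ : star (Q (.inr 0) (.inr 0)) = 1 - Q (.inl 0) (.inl 0) := by
    simpa [sharp, one_apply] using congrFun (congrFun hs (.inl 0)) (.inl 0)
  have h₂ : star (Q (.inr 0) (.inl 0)) = - Q (.inl 0) (.inr 0) := by
    simpa [sharp, one_apply] using congrFun (congrFun hs (.inl 0)) (.inr 0)
  have h₃ : star (Q (.inr 0) (.inr 0)) = Q (.inr 0) (.inr 0) := by
    simpa [flat, J, Matrix.mul_apply, fromBlocks, one_apply]
      using congrFun (congrFun hf (.inr 0)) (.inr 0)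
  rw [h₃] at h₁
  ext i j
  rcases i with i | i <;> rcases j with j | j <;>
    simp [Matrix.mul_apply, J, fromBlocks, one_apply, Fin.fin_one_eq_zero, h₁] <;> ring

/-- An isometric doubled-up matrix with the same range as `X`, where `X` is anti-doubled-up and
`X♭ X` is a negative multiple of the identity. -/
theorem exists_isometry_mul {X : Matrix (κ ⊕ κ) (ι ⊕ ι) ℂ} (hs : sharp X = -X) {δ : ℝ}
    (hδ : 0 < δ) (hX : flat X * X = -((δ : ℂ) • 1)) :
    ∃ (U : Matrix (κ ⊕ κ) (ι ⊕ ι) ℂ) (Z Z' : Matrix (ι ⊕ ι) (ι ⊕ ι) ℂ),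
      sharp U = U ∧ flat U * U = 1 ∧ X = U * Z ∧ Z * Z' = 1 := by
  set S : Matrix (ι ⊕ ι) (ι ⊕ ι) ℂ := fromBlocks 0 1 1 0 with hS
  have hSs : sharp S = S := by
    ext i j
    rcases i with i | i <;> rcases j with j | j <;>
      simp [hS, sharp, one_apply, apply_ite]
  have hSf : flat S = -S := by
    simp [hS, flat, J, fromBlocks_conjTranspose, fromBlocks_multiply, fromBlocks_neg]
  have hSS : S * S = 1 := by simp [hS, fromBlocks_multiply]
  set t : ℂ := ((Real.sqrt δ : ℝ) : ℂ) with ht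
  have htt : t * t = δ := by
    rw [ht, ← Complex.ofReal_mul, Real.mul_self_sqrt hδ.le]
  have ht0 : t ≠ 0 := by
    rw [ht]; exact_mod_cast (Real.sqrt_pos.2 hδ).ne'
  have hts : star t = t := Complex.conj_ofReal _
  set c : ℂ := Complex.I * t⁻¹ with hc
  have hcs : star c = -c := by
    simp only [hc, star_mul', star_inv₀, hts, Complex.star_def, Complex.conj_I, neg_mul]
  have hcc : star c * c * δ = 1 := by
    rw [hcs, hc, ← htt]
    field_simp
    simp
  have hc0 : c ≠ 0 := mul_ne_zero Complex.I_ne_zero (inv_ne_zero ht0)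
  -- The swap `S` has `S♭ = -S` and so reverses the sign of `X♭X`; in `c = i/√δ`, the factor `i`
  -- turns anti-doubled-up into doubled-up and `1/√δ` normalizes.
  refine ⟨c • (X * S), c⁻¹ • S, c • S, ?_, ?_, ?_, ?_⟩
  · rw [sharp_smul, sharp_mul, hs, hSs, hcs, Matrix.neg_mul, neg_smul, smul_neg, neg_neg]
  · rw [flat_smul, flat_mul, Matrix.smul_mul, Matrix.mul_smul, smul_smul, Matrix.mul_assoc,
      mul_mul_of_mul_eq hX, hSf]
    simp only [Matrix.neg_mul, Matrix.smul_mul, Matrix.one_mul, Matrix.mul_neg, smul_neg, neg_neg,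
      Matrix.mul_smul, hSS, smul_smul, hcc, one_smul]
  · rw [Matrix.smul_mul, Matrix.mul_smul, smul_smul, mul_inv_cancel₀ hc0, one_smul,
      Matrix.mul_assoc, hSS, Matrix.mul_one]
  · rw [Matrix.smul_mul, Matrix.mul_smul, smul_smul, inv_mul_cancel₀ hc0, one_smul, hSS]

end Completion

/-! ### Cascades: block structure, transfer functions, stationary states -/

namespace QLS

variable {m : ℕ} {ι ι₁ ι₂ : Type} [Fintype ι] [DecidableEq ι] [Fintype ι₁] [DecidableEq ι₁]
  [Fintype ι₂] [DecidableEq ι₂]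

theorem ext_of_C_A {G G' : QLS m ι} (hC : G.C = G'.C) (hA : G.A = G'.A) : G = G' := by
  have inj : ∀ {κ : Type} {X Y X' Y' : Matrix κ ι ℂ}, doubleUp X Y = doubleUp X' Y' →
      X = X' ∧ Y = Y' := by
    intro κ X Y X' Y' h
    exact ⟨congrArg toBlocks₁₁ h, congrArg toBlocks₁₂ h⟩
  obtain ⟨h₁, h₂⟩ := inj hC
  obtain ⟨h₃, h₄⟩ := inj hA
  cases G
  cases G'
  simp_all

/-- The inclusion of the modes of the first system into those of the cascade. -/
abbrev inclL (ι₁ ι₂ : Type) [DecidableEq ι₁] [DecidableEq ι₂] [Fintype ι₁] [Fintype ι₂] :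
    Matrix ((ι₁ ⊕ ι₂) ⊕ (ι₁ ⊕ ι₂)) (ι₁ ⊕ ι₁) ℂ :=
  incl Sum.inl

/-- The inclusion of the modes of the second system into those of the cascade. -/
abbrev inclR (ι₁ ι₂ : Type) [DecidableEq ι₁] [DecidableEq ι₂] [Fintype ι₁] [Fintype ι₂] :
    Matrix ((ι₁ ⊕ ι₂) ⊕ (ι₁ ⊕ ι₂)) (ι₂ ⊕ ι₂) ℂ :=
  incl Sum.inr

local notation "E₁" => inclL ι₁ ι₂
local notation "E₂" => inclR ι₁ ι₂

theorem inclL_self : flat E₁ * E₁ = 1 := flat_incl_mul_incl_self Sum.inl_injective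

theorem inclR_self : flat E₂ * E₂ = 1 := flat_incl_mul_incl_self Sum.inr_injective

theorem inclL_inclR : flat E₁ * E₂ = 0 := flat_incl_mul_incl_of_disjoint (by simp)

theorem inclR_inclL : flat E₂ * E₁ = 0 := flat_incl_mul_incl_of_disjoint (by simp)

theorem incl_add : E₁ * flat E₁ + E₂ * flat E₂ = 1 := incl_mul_flat_add (Equiv.refl _)

variable (G₂ : QLS m ι₂) (G₁ : QLS m ι₁)

theorem series_C_mul_inclL : (G₂.series G₁).C * E₁ = G₁.C := by
  rw [mul_incl]
  ext i j
  have := congrFun (congrFun (series_C G₂ G₁) i) (.inl j)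
  rcases j with j | j <;> simpa using this

theorem series_C_mul_inclR : (G₂.series G₁).C * E₂ = G₂.C := by
  rw [mul_incl]
  ext i j
  have := congrFun (congrFun (series_C G₂ G₁) i) (.inr j)
  rcases j with j | j <;> simpa using this

theorem series_A_mul_inclR : (G₂.series G₁).A * E₂ = E₂ * G₂.A := by
  have h₁ : flat E₁ * ((G₂.series G₁).A * E₂) = 0 := by
    rw [mul_incl, flat_incl_mul]
    ext i j
    have := congrFun (congrFun (series_A G₂ G₁) (.inl i)) (.inr j)
    rcases i with i | i <;> rcases j with j | j <;> simpa using this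
  have h₂ : flat E₂ * ((G₂.series G₁).A * E₂) = G₂.A := by
    rw [mul_incl, flat_incl_mul]
    ext i j
    have := congrFun (congrFun (series_A G₂ G₁) (.inr i)) (.inr j)
    rcases i with i | i <;> rcases j with j | j <;> simpa using this
  rw [← Matrix.one_mul (_ * E₂), ← incl_add, Matrix.add_mul, Matrix.mul_assoc, h₁,
    Matrix.mul_assoc, h₂, Matrix.mul_zero, zero_add]

theorem series_A_mul_inclL :
    (G₂.series G₁).A * E₁ = E₁ * G₁.A - E₂ * (flat G₂.C * G₁.C) := by
  have h₁ : flat E₁ * ((G₂.series G₁).A * E₁) = G₁.A := by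
    rw [mul_incl, flat_incl_mul]
    ext i j
    have := congrFun (congrFun (series_A G₂ G₁) (.inl i)) (.inl j)
    rcases i with i | i <;> rcases j with j | j <;> simpa using this
  have h₂ : flat E₂ * ((G₂.series G₁).A * E₁) = -(flat G₂.C * G₁.C) := by
    rw [mul_incl, flat_incl_mul]
    ext i j
    have := congrFun (congrFun (series_A G₂ G₁) (.inr i)) (.inl j)
    rcases i with i | i <;> rcases j with j | j <;> simpa using this
  rw [← Matrix.one_mul (_ * E₁), ← incl_add, Matrix.add_mul, Matrix.mul_assoc, h₁,
    Matrix.mul_assoc, h₂, Matrix.mul_neg, sub_eq_add_neg]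

theorem series_C_eq : (G₂.series G₁).C = G₁.C * flat E₁ + G₂.C * flat E₂ := by
  rw [← series_C_mul_inclL G₂ G₁, ← series_C_mul_inclR G₂ G₁, Matrix.mul_assoc, Matrix.mul_assoc,
    ← Matrix.mul_add, incl_add, Matrix.mul_one]

theorem series_A_eq : (G₂.series G₁).A
    = E₁ * G₁.A * flat E₁ - E₂ * (flat G₂.C * G₁.C) * flat E₁ + E₂ * G₂.A * flat E₂ := by
  rw [← Matrix.sub_mul, ← series_A_mul_inclL, ← series_A_mul_inclR, Matrix.mul_assoc,
    Matrix.mul_assoc, ← Matrix.mul_add, incl_add, Matrix.mul_one]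

theorem flat_inclL_mul_series_A : flat E₁ * (G₂.series G₁).A = G₁.A * flat E₁ := by
  rw [series_A_eq]
  simp only [Matrix.mul_add, Matrix.mul_sub, Matrix.mul_assoc, mul_mul_of_mul_eq inclL_self,
    mul_mul_of_mul_eq inclL_inclR, Matrix.one_mul, Matrix.zero_mul, sub_zero, add_zero]

/-- A system that is block lower triangular in the modes selected by `K` and `L` is a cascade. -/
theorem series_pull_pull (G : QLS m ι) {K : Matrix (ι ⊕ ι) (ι₁ ⊕ ι₁) ℂ}
    {L : Matrix (ι ⊕ ι) (ι₂ ⊕ ι₂) ℂ} (hK : sharp K = K) (hL : sharp L = L)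
    (h : flat K * G.A * L = 0) :
    (G.pull L hL).series (G.pull K hK) = G.pull (K * flat E₁ + L * flat E₂)
      (by simp [sharp_mul, sharp_flat, hK, hL]) := by
  apply ext_of_C_A
  · rw [series_C_eq, pull_C, pull_C, pull_C, Matrix.mul_add]
    simp only [Matrix.mul_assoc]
  · have h' : flat L * G.A * K = -(flat (G.C * L) * (G.C * K)) := by
      have := congrArg flat h
      rw [flat_mul, flat_mul, flat_flat, flat_A, flat_zero] at this
      rw [eq_neg_iff_add_eq_zero, ← neg_eq_zero, ← this, flat_mul]
      simp only [Matrix.sub_mul, Matrix.mul_sub, Matrix.mul_assoc, Matrix.neg_mul, Matrix.mul_neg]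
      abel
    rw [series_A_eq, pull_C, pull_C, pull_A, pull_A, pull_A, sub_eq_add_neg,
      ← Matrix.neg_mul, ← Matrix.mul_neg, ← h']
    have e : flat (K * flat E₁ + L * flat E₂) * G.A * (K * flat E₁ + L * flat E₂)
        = E₁ * (flat K * G.A * K) * flat E₁ + E₂ * (flat L * G.A * K) * flat E₁
          + E₂ * (flat L * G.A * L) * flat E₂ + E₁ * (flat K * G.A * L) * flat E₂ := by
      simp only [flat_add, flat_mul, flat_flat, Matrix.add_mul, Matrix.mul_add, Matrix.mul_assoc]
      abel
    rw [e, h, Matrix.mul_zero, Matrix.zero_mul, add_zero]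

theorem resolvent_series {s : ℂ} (h₁ : s ∉ spectrum ℂ G₁.A) (h₂ : s ∉ spectrum ℂ G₂.A) :
    (s • (1 : Matrix ((ι₁ ⊕ ι₂) ⊕ (ι₁ ⊕ ι₂)) ((ι₁ ⊕ ι₂) ⊕ (ι₁ ⊕ ι₂)) ℂ) - (G₂.series G₁).A) *
      (E₁ * (s • (1 : Matrix (ι₁ ⊕ ι₁) (ι₁ ⊕ ι₁) ℂ) - G₁.A)⁻¹ * flat E₁
        + E₂ * (s • (1 : Matrix (ι₂ ⊕ ι₂) (ι₂ ⊕ ι₂) ℂ) - G₂.A)⁻¹ * flat E₂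
        - E₂ * ((s • (1 : Matrix (ι₂ ⊕ ι₂) (ι₂ ⊕ ι₂) ℂ) - G₂.A)⁻¹ * (flat G₂.C * G₁.C)
            * (s • (1 : Matrix (ι₁ ⊕ ι₁) (ι₁ ⊕ ι₁) ℂ) - G₁.A)⁻¹) * flat E₁) = 1 := by
  have r₁ := resolvent_mul_inv h₁
  have r₂ := resolvent_mul_inv h₂
  set R := s • (1 : Matrix ((ι₁ ⊕ ι₂) ⊕ (ι₁ ⊕ ι₂)) ((ι₁ ⊕ ι₂) ⊕ (ι₁ ⊕ ι₂)) ℂ) - (G₂.series G₁).A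
    with hR
  set R₁ := s • (1 : Matrix (ι₁ ⊕ ι₁) (ι₁ ⊕ ι₁) ℂ) - G₁.A with hR₁
  set R₂ := s • (1 : Matrix (ι₂ ⊕ ι₂) (ι₂ ⊕ ι₂) ℂ) - G₂.A with hR₂
  have e₁ : R * E₁ = E₁ * R₁ + E₂ * (flat G₂.C * G₁.C) := by
    rw [hR, hR₁, Matrix.sub_mul, Matrix.mul_sub, series_A_mul_inclL]
    simp
    abel
  have e₂ : R * E₂ = E₂ * R₂ := by
    rw [hR, hR₂, Matrix.sub_mul, Matrix.mul_sub, series_A_mul_inclR]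
    simp
  simp only [Matrix.mul_sub, Matrix.mul_add, ← Matrix.mul_assoc R, e₁, e₂, Matrix.add_mul]
  rw [← incl_add, Matrix.mul_assoc E₁ R₁, r₁, Matrix.mul_assoc E₂ R₂, r₂,
    ← Matrix.mul_assoc (E₂ * R₂), ← Matrix.mul_assoc (E₂ * R₂), Matrix.mul_assoc E₂ R₂, r₂]
  simp only [Matrix.mul_one, Matrix.mul_assoc]
  abel

theorem notMem_spectrum_series {s : ℂ} (h₁ : s ∉ spectrum ℂ G₁.A) (h₂ : s ∉ spectrum ℂ G₂.A) :
    s ∉ spectrum ℂ (G₂.series G₁).A :=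
  notMem_spectrum_of_mul_eq_one (mul_eq_one_comm.1 (resolvent_series G₂ G₁ h₁ h₂))

theorem transfer_series {s : ℂ} (h₁ : s ∉ spectrum ℂ G₁.A) (h₂ : s ∉ spectrum ℂ G₂.A) :
    (G₂.series G₁).transfer s = G₂.transfer s * G₁.transfer s := by
  have hC₁ : flat E₁ * flat (G₂.series G₁).C = flat G₁.C := by
    rw [← flat_mul, series_C_mul_inclL]
  have hC₂ : flat E₂ * flat (G₂.series G₁).C = flat G₂.C := by
    rw [← flat_mul, series_C_mul_inclR]
  rw [transfer, inv_eq_right_inv (resolvent_series G₂ G₁ h₁ h₂), transfer, transfer]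
  simp only [Matrix.mul_sub, Matrix.sub_mul, Matrix.mul_add, Matrix.add_mul, Matrix.mul_assoc,
    Matrix.one_mul, Matrix.mul_one, hC₁, hC₂]
  simp only [← Matrix.mul_assoc, series_C_mul_inclL, series_C_mul_inclR]
  abel

/-- If a cascade and its second system have a trivial power spectrum at `s`, so has the first. -/
theorem powerSpectrum_eq_vac_of_series {s : ℂ} (h₁ : G₁.IsRegularAt s) (h₂ : G₂.IsRegularAt s)
    (hs : (G₂.series G₁).powerSpectrum s = vac (Fin m)) (h : G₂.powerSpectrum s = vac (Fin m)) :
    G₁.powerSpectrum s = vac (Fin m) := by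
  have hreg : (G₂.series G₁).IsRegularAt s :=
    ⟨notMem_spectrum_series G₂ G₁ h₁.1 h₂.1, notMem_spectrum_series G₂ G₁ h₁.2 h₂.2⟩
  rw [powerSpectrum_eq_vac_iff _ hreg, transfer_series G₂ G₁ h₁.1 h₂.1] at hs
  rw [powerSpectrum_eq_vac_iff _ h₂] at h
  rw [powerSpectrum_eq_vac_iff _ h₁]
  have hinv := mul_eq_one_comm.1 (G₂.transfer_mul_flat h₂)
  rw [← Matrix.mul_assoc, ← h, Matrix.mul_assoc, Matrix.mul_assoc] at hs
  have := congrArg (flat (G₂.transfer (-star s)) * ·) hs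
  simpa only [mul_mul_of_mul_eq hinv, Matrix.one_mul] using this

/-- A stationary state of a cascade restricts to one of the first system. -/
theorem IsStationaryCov.of_series {Q : Matrix ((ι₁ ⊕ ι₂) ⊕ (ι₁ ⊕ ι₂)) ((ι₁ ⊕ ι₂) ⊕ (ι₁ ⊕ ι₂)) ℂ}
    (h : (G₂.series G₁).IsStationaryCov (Q * J _)) :
    G₁.IsStationaryCov (flat E₁ * Q * E₁ * J _) := by
  rw [isStationaryCov_iff] at h ⊢
  have e := congrArg (fun X => flat E₁ * X * E₁) h
  simp only [Matrix.mul_zero, Matrix.zero_mul] at e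
  have hC : flat E₁ * flat (G₂.series G₁).C = flat G₁.C := by
    rw [← flat_mul, series_C_mul_inclL]
  have hCC : flat (G₂.series G₁).C = E₁ * flat G₁.C + E₂ * flat G₂.C := by
    rw [series_C_eq, flat_add, flat_mul, flat_mul, flat_flat, flat_flat]
  rw [← e]
  simp only [Matrix.mul_sub, Matrix.sub_mul, Matrix.mul_add, Matrix.add_mul, Matrix.mul_assoc,
    series_C_mul_inclL, series_A_mul_inclL, mul_mul_of_mul_eq hC,
    mul_mul_of_mul_eq (flat_inclL_mul_series_A G₂ G₁)]
  -- The terms through `E₂` cancel: `QC♭C` contributes `Q E₂ C₂♭C₁`, and the cascade block of `A`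
  -- contributes its negative.
  rw [hCC]
  simp only [Matrix.mul_add, Matrix.add_mul, Matrix.mul_assoc]
  abel

theorem powerSpectrum_of_isEmpty [IsEmpty ι] (G : QLS m ι) (s : ℂ) :
    G.powerSpectrum s = vac (Fin m) := by
  have h : ∀ s, G.transfer s = 1 := by
    intro s
    have : G.C = 0 := by
      ext i j
      exact isEmptyElim j
    simp [transfer, this]
  simp [powerSpectrum, h]

/-- The competitor is the system without modes, which is vacuously stable and transmits the vacuum
unchanged. -/
theorem not_hasTrivialPowerSpectrum (G : QLS m (Fin 1)) (h : G.IsGloballyMinimal) :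
    ¬ G.HasTrivialPowerSpectrum := by
  intro ht
  let G₀ : QLS m (Fin 0) := ⟨0, 0, 0, 0, by ext i; exact isEmptyElim i⟩
  refine h 0 (by simp) G₀ ?_ ?_
  · intro z hz
    rw [spectrum.of_subsingleton] at hz
    exact hz.elim
  · intro s _ hs
    rw [powerSpectrum_of_isEmpty, ht s hs]

end QLS

/-! ### The mode correlated with the first system -/

namespace QLS

/-- If the first system of a purely stationary cascade is globally minimal with one mode, its modes
are correlated with a symplectic pair `U` of modes of the second system, and with no others. -/
theorem exists_correlated_mode {m : ℕ} {ι : Type} [Fintype ι] [DecidableEq ι]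
    (G₁ : QLS m (Fin 1)) (G₂ : QLS m ι) (hmin : G₁.IsGloballyMinimal)
    {Q : Matrix ((Fin 1 ⊕ ι) ⊕ (Fin 1 ⊕ ι)) ((Fin 1 ⊕ ι) ⊕ (Fin 1 ⊕ ι)) ℂ} (hQ : IsPureProj Q)
    (hst : (G₂.series G₁).IsStationaryCov (Q * J _)) :
    ∃ (U : Matrix (ι ⊕ ι) (Fin 1 ⊕ Fin 1) ℂ) (Z Z' : Matrix (Fin 1 ⊕ Fin 1) (Fin 1 ⊕ Fin 1) ℂ),
      sharp U = U ∧ flat U * U = 1 ∧ flat (inclR (Fin 1) ι) * Q * inclL (Fin 1) ι = U * Z ∧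
        Z * Z' = 1 := by
  set E₁ := inclL (Fin 1) ι with hE₁
  set E₂ := inclR (Fin 1) ι with hE₂
  set Q₁ := flat E₁ * Q * E₁ with hQ₁
  set X := flat E₂ * Q * E₁ with hX
  have hs₁ : sharp E₁ = E₁ := sharp_incl _
  have hs₂ : sharp E₂ = E₂ := sharp_incl _
  have hf : flat Q₁ = Q₁ := by
    simp only [hQ₁, flat_mul, flat_flat, hQ.flat_eq, Matrix.mul_assoc]
  have hs : sharp Q₁ = 1 - Q₁ := by
    simp only [hQ₁, sharp_mul, sharp_flat, hs₁, hQ.sharp_eq, Matrix.mul_sub, Matrix.sub_mul,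
      Matrix.mul_one]
    rw [hE₁, inclL_self]
  have hp : (Q₁ * J (Fin 1)).PosSemidef := by
    have := hQ.posSemidef.mul_mul_conjTranspose_same (flat E₁)
    rw [conjTranspose_eq_flat, flat_flat] at this
    simpa only [hQ₁, Matrix.mul_assoc, J_mul_J_mul] using this
  have hXs : sharp X = -X := by
    simp only [hX, sharp_mul, sharp_flat, hs₁, hs₂, hQ.sharp_eq, Matrix.mul_sub, Matrix.sub_mul,
      Matrix.mul_one]
    rw [hE₁, hE₂, inclR_inclL, zero_sub]
  -- This is the first diagonal block of `Q² = Q`.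
  have hXX : Q₁ * Q₁ + flat X * X = Q₁ := by
    have e : Q₁ * Q₁ + flat X * X = flat E₁ * Q * (E₁ * flat E₁ + E₂ * flat E₂) * Q * E₁ := by
      simp only [hQ₁, hX, flat_mul, flat_flat, hQ.flat_eq, Matrix.mul_add, Matrix.add_mul,
        Matrix.mul_assoc]
    rw [e, hE₁, hE₂, incl_add, Matrix.mul_one, Matrix.mul_assoc _ Q Q, hQ.mul_self]
  obtain ⟨δ, hδ, hδ'⟩ := exists_mul_self_sub_of_oneMode hf hs hp
  have hδ0 : δ ≠ 0 := by
    rintro rfl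
    have hm : Q₁ * Q₁ = Q₁ := by
      rw [Complex.ofReal_zero, zero_smul, sub_eq_zero] at hδ'
      exact hδ'
    exact not_hasTrivialPowerSpectrum G₁ hmin
      ((isPassiveFor_of_isStationaryCov hm hf hs hst.of_series).hasTrivialPowerSpectrum hf)
  refine exists_isometry_mul hXs (lt_of_le_of_ne hδ hδ0.symm) ?_
  rw [← hδ', neg_sub, eq_sub_iff_add_eq, add_comm, hXX]

end QLS

end QuantumLinear

/-! ### Splitting off a pair of modes -/

open QuantumLinear QuantumLinear.QLS in
theorem mainTheorem9 (m r : ℕ)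
    (G₁ : QuantumLinear.QLS m (Fin 1)) (G₂ : QuantumLinear.QLS m (Fin r))
    (hG₁ : G₁.IsHurwitz) (hG₂ : G₂.IsHurwitz)
    (hmin : G₁.IsGloballyMinimal)
    (hpure : (G₂.series G₁).HasPureStationaryState) :
    ∃ k : ℕ, r = k + 1 ∧
      ∃ (G₂₁ : QuantumLinear.QLS m (Fin 1)) (G₂₂ : QuantumLinear.QLS m (Fin k)),
        G₂₁.IsHurwitz ∧ G₂₂.IsHurwitz ∧
        (G₂₂.series G₂₁).TransferEquiv G₂ ∧
        G₂₁.IsGloballyMinimal ∧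
        (G₂₁.series G₁).HasPureStationaryState ∧
        (G₂₁.series G₁).HasTrivialPowerSpectrum ∧
        G₂₂.HasPureStationaryState ∧
        G₂₂.PowerEquiv (G₂.series G₁) := by
  obtain ⟨P, hst, hP⟩ := hpure
  obtain ⟨Q, hQ, hst⟩ : ∃ Q, IsPureProj Q ∧ (G₂.series G₁).IsStationaryCov (Q * J _) :=
    ⟨P * J _, hP.isPureProj, by rwa [Matrix.mul_assoc, J_mul_J, Matrix.mul_one]⟩
  have hpass := isPassiveFor_of_isStationaryCov hQ.mul_self hQ.flat_eq hQ.sharp_eq hst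
  obtain ⟨U, Z, Z', hU, hUU, hUZ, hZ⟩ := exists_correlated_mode G₁ G₂ hmin hQ hst
  obtain ⟨k, rfl, W, hW, hWW, hUW, hadd⟩ := exists_symplectic_completion hU hUU
  refine ⟨k, rfl, G₂.pull U hU, G₂.pull W hW, ?_⟩
  set E₁ := inclL (Fin 1) (Fin (k + 1)) with hE₁
  set E₂ := inclR (Fin 1) (Fin (k + 1)) with hE₂
  have hs₁ : sharp E₁ = E₁ := sharp_incl _
  have hs₂ : sharp E₂ = E₂ := sharp_incl _
  have h11 : flat E₁ * E₁ = 1 := inclL_self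
  have h22 : flat E₂ * E₂ = 1 := inclR_self
  have h12 : flat E₁ * E₂ = 0 := inclL_inclR
  have h21 : flat E₂ * E₁ = 0 := inclR_inclL
  have hEE : E₁ * flat E₁ + E₂ * flat E₂ = 1 := incl_add
  have hAE : (G₂.series G₁).A * E₂ = E₂ * G₂.A := series_A_mul_inclR G₂ G₁
  have hEA : flat E₁ * (G₂.series G₁).A = G₁.A * flat E₁ := flat_inclL_mul_series_A G₂ G₁
  have hWU : flat W * U = 0 := by
    have := congrArg flat hUW
    rwa [flat_mul, flat_flat, flat_zero] at this
  have hZf : flat Z * flat Z' = 1 := flat_inv _ hZ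
  have hZf' : flat Z' * flat Z = 1 := mul_eq_one_comm.1 hZf
  have hQ12 : flat E₁ * Q * E₂ = flat Z * flat U := by
    have := congrArg flat hUZ
    simpa only [flat_mul, flat_flat, hQ.flat_eq, Matrix.mul_assoc] using this
  -- The off-diagonal block of `AQ = QA`: `E₁♭` carries `A` to `A₁` and `E₂` carries `A₂` to `A`.
  have hZA : flat Z * flat U * G₂.A = G₁.A * (flat Z * flat U) := by
    rw [← hQ12, Matrix.mul_assoc _ E₂, ← hAE]
    simp only [← Matrix.mul_assoc]
    rw [Matrix.mul_assoc (flat E₁) Q, ← hpass.1, ← Matrix.mul_assoc, hEA]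
  have hUA : flat U * G₂.A * W = 0 := by
    have : flat Z * (flat U * G₂.A * W) = 0 := by
      rw [← Matrix.mul_assoc, ← Matrix.mul_assoc, hZA]
      simp only [Matrix.mul_assoc, hUW, Matrix.mul_zero]
    rw [← Matrix.one_mul (flat U * G₂.A * W), ← hZf', Matrix.mul_assoc, this, Matrix.mul_zero]
  -- Similarity to `A₁` provides both stability of the new one-mode system and, later, the same
  -- regular points.
  have hsim : G₁.A * flat Z = flat Z * (G₂.pull U hU).A := by
    rw [pull_A, ← Matrix.mul_assoc, ← Matrix.mul_assoc, hZA]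
    simp only [Matrix.mul_assoc, hUU, Matrix.mul_one]
  have hsim' : (G₂.pull U hU).A * flat Z' = flat Z' * G₁.A := by
    calc (G₂.pull U hU).A * flat Z' = flat Z' * (flat Z * (G₂.pull U hU).A) * flat Z' := by
          rw [← Matrix.mul_assoc, hZf', Matrix.one_mul]
      _ = flat Z' * G₁.A := by
          rw [← hsim, Matrix.mul_assoc, Matrix.mul_assoc, hZf, Matrix.mul_one]
  have hspec : spectrum ℂ (G₂.pull U hU).A = spectrum ℂ G₁.A :=
    (spectrum_subset_of_intertwine hZf' hsim).antisymm (spectrum_subset_of_intertwine hZf hsim')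
  -- The range of `W` is invariant under `A₂`, so the remaining system inherits its stability.
  have hWA : G₂.A * W = W * (G₂.pull W hW).A := by
    rw [pull_A, ← Matrix.one_mul (G₂.A * W), ← hadd, Matrix.add_mul]
    simp only [Matrix.mul_assoc] at hUA ⊢
    rw [hUA, Matrix.mul_zero, zero_add]
  -- The first two modes of the cascade, and the remaining ones.
  have hKL : flat E₁ * (G₂.series G₁).A * (E₂ * U) = 0 := by
    rw [hEA, Matrix.mul_assoc, mul_mul_of_mul_eq h12, Matrix.zero_mul, Matrix.mul_zero]
  have hE₂U : sharp (E₂ * U) = E₂ * U := by rw [sharp_mul, hs₂, hU]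
  have hE₂W : sharp (E₂ * W) = E₂ * W := by rw [sharp_mul, hs₂, hW]
  have hG₁' : (G₂.series G₁).pull E₁ hs₁ = G₁ :=
    ext_of_C_A (by rw [pull_C, hE₁, series_C_mul_inclL])
      (by rw [pull_A, hEA, Matrix.mul_assoc, h11, Matrix.mul_one])
  have hpull : ∀ {ν : Type} [Fintype ν] [DecidableEq ν]
      (V : Matrix (Fin (k + 1) ⊕ Fin (k + 1)) (ν ⊕ ν) ℂ) (hV : sharp V = V)
      (hV' : sharp (E₂ * V) = E₂ * V), (G₂.series G₁).pull (E₂ * V) hV' = G₂.pull V hV := by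
    intro ν _ _ V hV hV'
    apply ext_of_C_A
    · rw [pull_C, pull_C, ← Matrix.mul_assoc, hE₂, series_C_mul_inclR]
    · rw [pull_A, pull_A, flat_mul]
      simp only [Matrix.mul_assoc]
      rw [mul_mul_of_mul_eq hAE]
      simp only [Matrix.mul_assoc, mul_mul_of_mul_eq h22, Matrix.one_mul]
  set F₁ := inclL (Fin 1) (Fin 1) with hF₁
  set F₂ := inclR (Fin 1) (Fin 1) with hF₂
  have f11 : flat F₁ * F₁ = 1 := inclL_self
  have f22 : flat F₂ * F₂ = 1 := inclR_self
  have f12 : flat F₁ * F₂ = 0 := inclL_inclR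
  have f21 : flat F₂ * F₁ = 0 := inclR_inclL
  have fadd : F₁ * flat F₁ + F₂ * flat F₂ = 1 := incl_add
  set K := E₁ * flat F₁ + E₂ * U * flat F₂ with hK
  set L := E₂ * W with hL
  have hKs : sharp K = K := by
    rw [hK, sharp_add, sharp_mul, sharp_mul, hE₂U, hs₁, sharp_flat, sharp_flat, hF₁, hF₂,
      sharp_incl, sharp_incl]
  have hser : (G₂.pull U hU).series G₁ = (G₂.series G₁).pull K hKs := by
    rw [← series_pull_pull _ hs₁ hE₂U hKL, hG₁', hpull U hU hE₂U]
  have hKf : flat K = F₁ * flat E₁ + F₂ * flat U * flat E₂ := by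
    simp only [hK, flat_add, flat_mul, flat_flat, Matrix.mul_assoc]
  have hKK : flat K * K = 1 := by
    rw [hKf, hK]
    simp only [Matrix.mul_add, Matrix.add_mul, Matrix.mul_assoc, mul_mul_of_mul_eq h11,
      mul_mul_of_mul_eq h12, mul_mul_of_mul_eq h21, mul_mul_of_mul_eq h22, Matrix.one_mul,
      Matrix.zero_mul, Matrix.mul_zero, mul_mul_of_mul_eq hUU, add_zero, zero_add, fadd]
  have hLL : flat L * L = 1 := by
    rw [hL, flat_mul, Matrix.mul_assoc, mul_mul_of_mul_eq h22, Matrix.one_mul, hWW]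
  have hKLadd : K * flat K + L * flat L = 1 := by
    have e₁ : K * flat K = E₁ * flat E₁ + E₂ * (U * flat U) * flat E₂ := by
      rw [hKf, hK]
      simp only [Matrix.mul_add, Matrix.add_mul, Matrix.mul_assoc, mul_mul_of_mul_eq f11,
        mul_mul_of_mul_eq f12, mul_mul_of_mul_eq f21, mul_mul_of_mul_eq f22, Matrix.one_mul,
        Matrix.zero_mul, Matrix.mul_zero, add_zero, zero_add]
    have e₂ : L * flat L = E₂ * (W * flat W) * flat E₂ := by
      simp only [hL, flat_mul, Matrix.mul_assoc]
    rw [e₁, e₂, add_assoc, ← Matrix.add_mul, ← Matrix.mul_add, hadd, Matrix.mul_one, hEE]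
  -- The correlations of `G₁` with `G₂` lie in the range of `U`, which `W♭` annihilates.
  have hLQ₁ : flat L * Q * E₁ = 0 := by
    rw [hL, flat_mul, Matrix.mul_assoc, Matrix.mul_assoc, ← Matrix.mul_assoc (flat E₂), hUZ,
      mul_mul_of_mul_eq hWU, Matrix.zero_mul]
  have hLQ₂ : flat L * Q * (E₂ * U) = 0 := by
    -- The range of `E₂ U` is that of `E₂ E₂♭ Q E₁ = Q E₁ - E₁ E₁♭ Q E₁`.
    have e : E₂ * U * Z = Q * E₁ - E₁ * (flat E₁ * Q * E₁) := by
      rw [Matrix.mul_assoc, ← hUZ, eq_sub_iff_add_eq']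
      simp only [← Matrix.mul_assoc]
      rw [← Matrix.add_mul, ← Matrix.add_mul, hEE, Matrix.one_mul]
    have e' : flat L * Q * (E₂ * U * Z) = 0 := by
      rw [e, Matrix.mul_sub, ← Matrix.mul_assoc, Matrix.mul_assoc _ Q Q, hQ.mul_self, hLQ₁,
        ← Matrix.mul_assoc _ E₁, hLQ₁, Matrix.zero_mul, sub_zero]
    rw [← Matrix.mul_one (flat L * Q * (E₂ * U)), ← hZ, ← Matrix.mul_assoc,
      Matrix.mul_assoc _ (E₂ * U) Z, e', Matrix.zero_mul]
  have hLQ : flat L * Q * K = 0 := by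
    rw [hK, Matrix.mul_add, ← Matrix.mul_assoc, ← Matrix.mul_assoc, hLQ₁, hLQ₂, Matrix.zero_mul,
      Matrix.zero_mul, add_zero]
  have hKQ : flat K * Q * L = 0 := by
    have := congrArg flat hLQ
    simpa only [flat_mul, flat_flat, hQ.flat_eq, flat_zero, Matrix.mul_assoc] using this
  have hQK : K * flat K * Q * K = Q * K := by
    rw [eq_sub_of_add_eq hKLadd, Matrix.sub_mul, Matrix.sub_mul, Matrix.one_mul, sub_eq_self,
      Matrix.mul_assoc, Matrix.mul_assoc, ← Matrix.mul_assoc (flat L), hLQ, Matrix.mul_zero]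
  have hQL : L * flat L * Q * L = Q * L := by
    rw [eq_sub_of_add_eq' hKLadd, Matrix.sub_mul, Matrix.sub_mul, Matrix.one_mul, sub_eq_self,
      Matrix.mul_assoc, Matrix.mul_assoc, ← Matrix.mul_assoc (flat K), hKQ, Matrix.mul_zero]
  have hpureK := hQ.pull hKs hKK hQK
  have hpassK : ((G₂.pull U hU).series G₁).IsPassiveFor (flat K * Q * K) := by
    rw [hser]
    exact hpass.pull hQ.flat_eq hKs hQK
  have hpureL := hQ.pull hE₂W hLL hQL
  have hpassL : (G₂.pull W hW).IsPassiveFor (flat L * Q * L) := by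
    rw [← hpull W hW hE₂W]
    exact hpass.pull hQ.flat_eq hE₂W hQL
  have htriv := hpassK.hasTrivialPowerSpectrum hpureK.flat_eq
  refine ⟨fun z hz => hG₁ z (hspec ▸ hz),
    fun z hz => hG₂ z (spectrum_subset_of_intertwine hWW hWA hz), ?_, ?_,
    hpassK.hasPureStationaryState hpureK, htriv, hpassL.hasPureStationaryState hpureL, ?_⟩
  · intro s _ hs
    rw [series_pull_pull G₂ hU hW hUA]
    refine transfer_pull _ _ _ ?_ ?_ hs
    · simp only [flat_add, flat_mul, flat_flat, Matrix.mul_add, Matrix.add_mul, Matrix.mul_assoc,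
        mul_mul_of_mul_eq hUU, mul_mul_of_mul_eq hUW, mul_mul_of_mul_eq hWU, mul_mul_of_mul_eq hWW,
        Matrix.one_mul, Matrix.zero_mul, Matrix.mul_zero, add_zero, zero_add, incl_add]
    · simp only [flat_add, flat_mul, flat_flat, Matrix.mul_add, Matrix.add_mul, Matrix.mul_assoc,
        mul_mul_of_mul_eq inclL_self, mul_mul_of_mul_eq inclL_inclR, mul_mul_of_mul_eq inclR_inclL,
        mul_mul_of_mul_eq inclR_self, Matrix.one_mul, Matrix.zero_mul, Matrix.mul_zero, add_zero,
        zero_add, hadd]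
  · intro j hj G' hG' heq
    -- A smaller competitor has no modes, so its spectrum is the vacuum; cancelling the second
    -- factor of the trivial cascade would then make `G₁` trivial, contradicting `hmin`.
    obtain rfl : j = 0 := by simpa using hj
    refine hmin 0 (by simp) G' hG' fun s hs hs₁ => ?_
    have hreg : (G₂.pull U hU).IsRegularAt s := by rwa [IsRegularAt, hspec]
    have h₂ := heq s hs hreg
    rw [powerSpectrum_of_isEmpty] at h₂ ⊢
    exact (powerSpectrum_eq_vac_of_series _ _ hs₁ hreg (htriv s
      ⟨notMem_spectrum_series _ _ hs₁.1 hreg.1, notMem_spectrum_series _ _ hs₁.2 hreg.2⟩)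
      h₂.symm).symm
  · intro s hs hs'
    rw [hpassL.hasTrivialPowerSpectrum hpureL.flat_eq s hs,
      hpass.hasTrivialPowerSpectrum hQ.flat_eq s hs']
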